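/- Let $\mathcal H$ be a complex Hilbert space and let $\mathcal F$ be the boson Fock space over $\mathcal H$, with number operator $\hat n$. For an orthonormal basis $f=(f_i)$ of $\mathcal H$ and an occupation list $\mathfrak n=(\mathfrak n(i))$ of nonnegative integers with finite sum, let $|\mathfrak n\rangle=|\mathfrak n\rangle_f$ be the corresponding normalized Fock basis vector. A density operator $\Gamma$ on $\mathcal F$ is called free if, for some orthonormal basis $(f_i)$ of $\mathcal H$, it has the form $$\Gamma=\sum_{\mathfrak n}\Big\{\prod_i(1-z_i)\,z_i^{\mathfrak n(i)}\Big\}\,|\mathfrak n\rangle\langle\mathfrak n|,\qquad z_i\in[0,1),\quad \sum_i z_i<\infty .$$ The $1$-matrix of a density operator $\Delta$ on $\mathcal F$ is the bounded Hermitian operator $\gamma_\Delta$ on $\mathcal H$ such that $\langle f_i|\gamma_\Delta|f_i\rangle=\sum_{\mathfrak n}\mathfrak n(i)\,\langle\mathfrak n|\Delta|\mathfrak n\rangle$ for every orthonormal basis $(f_i)$ of $\mathcal H$ and every $i$. For a density operator $\Gamma$ with eigenvalues $x$ and spectral projections $P_x$, let $\mathrm{Tr}(\Delta\log\Gamma)=\sum_x\log(x)\,\mathrm{Tr}(P_x\Delta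 P_x)\in[-\infty,0]$, where $\log 0=-\infty$ and $-\infty\cdot 0=0$, and, if $\mathrm{Tr}(\Delta\log\Delta)>-\infty$, let $$S(\Delta|\Gamma)=-\mathrm{Tr}(\Delta\log\Gamma)+\mathrm{Tr}(\Delta\log\Delta)\in[0,\infty].$$ Let $\Delta$ be a density operator on $\mathcal F$ that commutes with $\hat n$ and satisfies $\mathrm{Tr}(\hat n\Delta)<\infty$ and $\mathrm{Tr}(\Delta\log\Delta)>-\infty$. Then $\Delta$ has exactly one $1$-matrix $\gamma_\Delta$; it can be written as $\gamma_\Delta=\sum_i n_i|g_i\rangle\langle g_i|$ with an orthonormal system $(g_i)$ and real numbers $n_i$; and there is exactly one free density operator $\Gamma_\Delta$ whose $1$-matrix is $\gamma_\Delta$. Moreover: 1. For every such decomposition of $\gamma_\Delta$, all $n_i\ge 0$, and $$S(\Delta|\Gamma_\Delta)=\sum_i(1+n_i)\log(1+n_i)-\sum_i n_i\log n_i+\mathrm{Tr}(\Delta\log\Delta),$$ where $0\log 0=0$, the first sum is finite, and the second sum is a well-defined element of $[-\infty,\infty)$ (so that both sides may equal $+\infty$). 2. $S(\Delta|\Gamma_\Delta)=\min\{S(\Delta|\Gamma):\Gamma\text{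 a free density operator on }\mathcal F\}$. 3. If $\mathrm{Tr}(\Delta\log\Gamma_\Delta)>-\infty$, then this minimum is attained only at $\Gamma_\Delta$. -/

import Mathlib

open scoped ENNReal InnerProductSpace

universe u

namespace BosonFock

open scoped ComplexOrder

noncomputable section

/-! ### Positive operators, traces and density operators on a complex Hilbert space -/

section Operators

variable {E : Type u} [NormedAddCommGroup E] [InnerProductSpace ℂ E] [CompleteSpace E]

/-- The trace of a positive bounded operator `A`, as a number in `[0, ∞]`: the sum of the diagonal
matrix elements of `A` in an orthonormal basis. (The value does not depend on the basis.) -/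
def posTrace (A : E →L[ℂ] E) : ℝ≥0∞ :=
  ∑' e : (exists_hilbertBasis ℂ E).choose, ENNReal.ofReal (⟪(e : E), A e⟫_ℂ).re

variable (E) in
/-- A density operator: a positive bounded operator of trace one. -/
structure DensityOperator where
  /-- The underlying bounded operator. -/
  op : E →L[ℂ] E
  isPositive : op.IsPositive
  trace_eq_one : posTrace op = 1

/-- The orthogonal projection onto the eigenspace `{ψ | A ψ = x ψ}` (it is zero if `x` is not an
eigenvalue of `A`). -/
def eigenProj (A : E →L[ℂ] E) (x : ℝ) : E →L[ℂ] E :=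
  (A - (x : ℂ) • ContinuousLinearMap.id ℂ E).ker.starProjection

/-- `-log x` for `x ∈ [0, 1]`, as a number in `[0, ∞]`, with `-log 0 = ∞`. -/
def negLog (x : ℝ) : ℝ≥0∞ := if x ≤ 0 then ⊤ else ENNReal.ofReal (-Real.log x)

/-- `Tr(Δ log Γ) ∈ [-∞, 0]` for density operators. As `Γ` has the spectral decomposition
`Γ = ∑ₓ x Pₓ`, with eigenvalues `x ∈ [0, 1]` and spectral projections `Pₓ`, this is
`∑ₓ log x · Tr(Pₓ Δ Pₓ)`, where `log 0 = -∞` and `-∞ · 0 = 0`. -/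
def traceLog (Δ Γ : DensityOperator E) : EReal :=
  -((∑' x : ℝ, negLog x * posTrace (eigenProj Γ.op x ∘L Δ.op ∘L eigenProj Γ.op x) : ℝ≥0∞) : EReal)

/-- The entropy `S(Δ|Γ) = -Tr(Δ log Γ) + Tr(Δ log Δ)` of `Δ` relative to `Γ`, for density operators
`Δ` with `Tr(Δ log Δ) > -∞`. -/
def relEntropy (Δ Γ : DensityOperator E) : EReal := -traceLog Δ Γ + traceLog Δ Δ

end Operators

/-! ### The boson Fock space -/

section FockSpace

variable {H : Type u} [NormedAddCommGroup H] [InnerProductSpace ℂ H]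

/-- The inner product of the symmetric products `u₁ ⋯ uₙ` and `v₁ ⋯ vₘ` in the boson Fock space:
`∑_σ ∏ᵢ ⟪uᵢ, v_{σ i}⟫` if `n = m`, where `σ` runs over all permutations, and `0` if `n ≠ m`
(there is then no bijection `σ`). -/
def symInner (u v : List H) : ℂ :=
  ∑ σ : Fin u.length ≃ Fin v.length, ∏ i, ⟪u.get i, v.get (σ i)⟫_ℂ

theorem star_symInner (u v : List H) : star (symInner u v) = symInner v u := by
  unfold symInner
  rw [star_sum]
  refine Fintype.sum_equiv ⟨Equiv.symm, Equiv.symm, fun _ => rfl, fun _ => rfl⟩ _ _ fun σ => ?_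
  rw [star_prod]
  refine Fintype.prod_equiv σ _ _ fun i => ?_
  simp

theorem posSemidef_gram {J : Type u} {V : Type*} [NormedAddCommGroup V]
    [InnerProductSpace ℂ V] (f : J → V) :
    (Matrix.of fun a b => ⟪f a, f b⟫_ℂ : Matrix J J ℂ).PosSemidef := by
  refine ⟨Matrix.IsHermitian.ext fun a b => inner_conj_symm _ _, fun x => ?_⟩
  have h : (x.sum fun a xa => x.sum fun b xb =>
      star xa * (Matrix.of fun a b => ⟪f a, f b⟫_ℂ : Matrix J J ℂ) a b * xb) =
      ⟪x.sum fun a xa => xa • f a, x.sum fun a xa => xa • f a⟫_ℂ := by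
    rw [Finsupp.sum_inner]
    refine Finsupp.sum_congr fun a _ => ?_
    rw [Finsupp.inner_sum]
    refine Finsupp.sum_congr fun b _ => ?_
    rw [inner_smul_left, inner_smul_right, Matrix.of_apply, starRingEnd_apply]
    ring
  rw [h, inner_self_eq_norm_sq_to_K, ← RCLike.ofReal_pow]
  exact RCLike.ofReal_nonneg.2 (sq_nonneg _)

theorem posSemidef_prod_inner {J : Type u} (n : ℕ) (f : J → Fin n → H) :
    (Matrix.of fun a b => ∏ k, ⟪f a k, f b k⟫_ℂ : Matrix J J ℂ).PosSemidef := by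
  have key : ∀ s : Finset (Fin n),
      (Matrix.of fun a b => ∏ k ∈ s, ⟪f a k, f b k⟫_ℂ : Matrix J J ℂ).PosSemidef := by
    intro s
    induction s using Finset.cons_induction with
    | empty => simpa using posSemidef_gram (fun _ : J => (1 : ℂ))
    | cons k s hk ih =>
      have h := (posSemidef_gram fun a : J => f a k).hadamard ih
      have e : (Matrix.of fun a b => ∏ k ∈ Finset.cons k s hk, ⟪f a k, f b k⟫_ℂ : Matrix J J ℂ) =
          (Matrix.of fun a b => ⟪f a k, f b k⟫_ℂ : Matrix J J ℂ).hadamard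
            (Matrix.of fun a b => ∏ k ∈ s, ⟪f a k, f b k⟫_ℂ) := by
        ext a b
        exact Finset.prod_cons hk
      rw [e]
      exact h
  exact key Finset.univ

theorem sum_prod_eq {n : ℕ} (u v : List H) (hn : n = u.length) :
    ∑ σ : Fin n ≃ Fin u.length, ∑ τ : Fin n ≃ Fin v.length,
      ∏ k, ⟪u.get (σ k), v.get (τ k)⟫_ℂ = (n.factorial : ℂ) * symInner u v := by
  subst hn
  have : ∀ σ : Fin u.length ≃ Fin u.length, ∑ τ : Fin u.length ≃ Fin v.length,
      ∏ k, ⟪u.get (σ k), v.get (τ k)⟫_ℂ = symInner u v := by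
    intro σ
    refine Fintype.sum_equiv ⟨fun τ => σ.symm.trans τ, fun τ => σ.trans τ,
      fun τ => by ext; simp, fun τ => by ext; simp⟩ _ _ fun τ => ?_
    refine Fintype.prod_equiv σ _ _ fun i => ?_
    simp
  rw [Finset.sum_congr rfl fun σ _ => this σ]
  simp [Fintype.card_perm]

theorem sum_prod_eq_zero {n : ℕ} (u v : List H) (hn : n ≠ u.length) :
    ∑ σ : Fin n ≃ Fin u.length, ∑ τ : Fin n ≃ Fin v.length,
      ∏ k, ⟪u.get (σ k), v.get (τ k)⟫_ℂ = 0 := by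
  refine Finset.sum_eq_zero fun σ _ => absurd ?_ hn
  simpa using Fintype.card_congr σ

theorem posSemidef_symInner :
    (Matrix.of symInner : Matrix (List H) (List H) ℂ).PosSemidef := by
  refine ⟨Matrix.IsHermitian.ext fun u v => star_symInner v u, fun x => ?_⟩
  have hC : ∀ n : ℕ, 0 ≤ x.sum fun u a => x.sum fun v b => star a *
      (∑ σ : Fin n ≃ Fin u.length, ∑ τ : Fin n ≃ Fin v.length,
        ∏ k, ⟪u.get (σ k), v.get (τ k)⟫_ℂ) * b := by
    intro n
    have := (posSemidef_prod_inner n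
      (fun (a : Σ l : List H, (Fin n ≃ Fin l.length)) k => a.1.get (a.2 k))).2
      (x.sum fun l c => ∑ σ : Fin n ≃ Fin l.length, Finsupp.single ⟨l, σ⟩ c)
    convert this using 1
    have key : ∀ (g : (Σ l : List H, (Fin n ≃ Fin l.length)) → ℂ → ℂ) (_ : ∀ a, g a 0 = 0)
        (_ : ∀ a b c, g a (b + c) = g a b + g a c),
        (x.sum fun l c => ∑ σ : Fin n ≃ Fin l.length,
            Finsupp.single (⟨l, σ⟩ : Σ l : List H, (Fin n ≃ Fin l.length)) c).sum g
          = x.sum fun l c => ∑ σ : Fin n ≃ Fin l.length, g ⟨l, σ⟩ c := by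
      intro g h0 hadd
      rw [Finsupp.sum_sum_index h0 hadd]
      refine Finsupp.sum_congr fun l _ => ?_
      rw [← Finsupp.sum_finsetSum_index h0 hadd]
      exact Finset.sum_congr rfl fun σ _ => Finsupp.sum_single_index (h0 _)
    rw [key _ (by intro a; simp) (by intro a b c; simp [add_mul])]
    refine Finsupp.sum_congr fun u _ => ?_
    rw [Finset.sum_congr rfl fun σ _ => key (fun b w => star (x u) * _ * w)
      (by intro a; exact mul_zero _) (by intro a b c; exact mul_add _ _ _)]
    rw [← Finsupp.sum_finsetSum_comm]
    refine Finsupp.sum_congr fun v _ => ?_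
    simp [Finset.mul_sum, Finset.sum_mul]
  set N := x.support.sup List.length + 1 with hN
  have hsum : (x.sum fun u a => x.sum fun v b => star a * Matrix.of symInner u v * b) =
      ∑ n ∈ Finset.range N, ((n.factorial : ℂ))⁻¹ *
      x.sum fun u a => x.sum fun v b => star a *
      (∑ σ : Fin n ≃ Fin u.length, ∑ τ : Fin n ≃ Fin v.length,
        ∏ k, ⟪u.get (σ k), v.get (τ k)⟫_ℂ) * b := by
    have swap : ∀ (s : Finset (List H)) (c : ℕ → ℂ) (F : ℕ → List H → List H → ℂ),
        ∑ n ∈ Finset.range N, c n * ∑ u ∈ s, ∑ v ∈ s, F n u v =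
          ∑ u ∈ s, ∑ v ∈ s, ∑ n ∈ Finset.range N, c n * F n u v := by
      intro s c F
      simp only [Finset.mul_sum]
      rw [Finset.sum_comm]
      exact Finset.sum_congr rfl fun u _ => Finset.sum_comm
    simp only [Finsupp.sum]
    rw [swap]
    refine Finset.sum_congr rfl fun u hu => Finset.sum_congr rfl fun v _ => ?_
    have hlt : u.length ∈ Finset.range N := by
      rw [Finset.mem_range, hN, Nat.lt_succ_iff]
      exact Finset.le_sup (f := List.length) hu
    rw [Finset.sum_eq_single_of_mem _ hlt]
    · have h := sum_prod_eq u v rfl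
      have hf : ((u.length.factorial : ℕ) : ℂ) ≠ 0 := by exact_mod_cast Nat.factorial_ne_zero _
      rw [h]
      simp only [Matrix.of_apply]
      field_simp
    · intro n _ hne
      have h := sum_prod_eq_zero u v hne
      rw [h]
      simp
  rw [hsum]
  refine Finset.sum_nonneg fun n _ => mul_nonneg ?_ (hC n)
  rw [inv_nonneg]
  exact Nat.cast_nonneg _

/-- The space of formal linear combinations of symmetric products `u₁ ⋯ uₙ` of vectors of `H`, of
any length `n ≥ 0` (the empty product is the vacuum). -/
def PreFock (H : Type u) : Type u := List H →₀ ℂ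

instance : AddCommGroup (PreFock H) := inferInstanceAs (AddCommGroup (List H →₀ ℂ))

instance : Module ℂ (PreFock H) := inferInstanceAs (Module ℂ (List H →₀ ℂ))

/-- The sesquilinear extension of `symInner`. -/
def preInner (f g : List H →₀ ℂ) : ℂ :=
  f.sum fun u a => g.sum fun v b => star a * symInner u v * b

theorem preInner_add_left (f g h : List H →₀ ℂ) :
    preInner (f + g) h = preInner f h + preInner g h := by
  unfold preInner
  rw [Finsupp.sum_add_index']
  · simp
  · intro u a b
    rw [← Finsupp.sum_add]
    simp [add_mul]

theorem preInner_smul_left (f g : List H →₀ ℂ) (c : ℂ) :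
    preInner (c • f) g = star c * preInner f g := by
  unfold preInner
  rw [Finsupp.sum_smul_index (by simp), Finsupp.mul_sum]
  refine Finsupp.sum_congr fun u _ => ?_
  rw [Finsupp.mul_sum]
  refine Finsupp.sum_congr fun v _ => ?_
  simp [mul_assoc]

theorem star_preInner (f g : List H →₀ ℂ) : star (preInner g f) = preInner f g := by
  unfold preInner
  rw [Finsupp.sum_comm]
  simp only [Finsupp.sum, star_sum]
  refine Finset.sum_congr rfl fun u _ => Finset.sum_congr rfl fun v _ => ?_
  simp only [star_mul', star_star, star_symInner]
  ring

instance instCore : PreInnerProductSpace.Core ℂ (PreFock H) where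
  inner f g := preInner f g
  conj_inner_symm f g := star_preInner f g
  re_inner_nonneg f := (Complex.le_def.1 (posSemidef_symInner.2 f)).1
  add_left f g h := preInner_add_left f g h
  smul_left f g c := preInner_smul_left f g c

instance : SeminormedAddCommGroup (PreFock H) :=
  InnerProductSpace.Core.toSeminormedAddCommGroup (𝕜 := ℂ)

instance : InnerProductSpace ℂ (PreFock H) := .ofCore _

/-- The boson Fock space over `H`: the Hilbert space completion of the linear combinations of
symmetric products `u₁ ⋯ uₙ` for the inner product `⟪u₁ ⋯ uₙ, v₁ ⋯ vₘ⟫ = symInner u v` (null vectors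
are divided out). -/
def Fock (H : Type u) [NormedAddCommGroup H] [InnerProductSpace ℂ H] : Type u :=
  UniformSpace.Completion (PreFock H)

instance : NormedAddCommGroup (Fock H) :=
  inferInstanceAs (NormedAddCommGroup (UniformSpace.Completion (PreFock H)))

instance : InnerProductSpace ℂ (Fock H) :=
  inferInstanceAs (InnerProductSpace ℂ (UniformSpace.Completion (PreFock H)))

instance : CompleteSpace (Fock H) :=
  inferInstanceAs (CompleteSpace (UniformSpace.Completion (PreFock H)))

/-- The symmetric product `u₁ ⋯ uₙ`, that is `a*(u₁) ⋯ a*(uₙ)` applied to the vacuum, as a vector of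
the boson Fock space. -/
def symProd (u : List H) : Fock H :=
  UniformSpace.Completion.coe' (α := PreFock H) (Finsupp.single u (1 : ℂ))

theorem inner_symProd (u v : List H) : ⟪symProd u, symProd v⟫_ℂ = symInner u v := by
  refine (UniformSpace.Completion.inner_coe (𝕜 := ℂ) (E := PreFock H) _ _).trans ?_
  change preInner (Finsupp.single u 1) (Finsupp.single v 1) = _
  simp [preInner]

theorem dense_span_symProd :
    (Submodule.span ℂ (Set.range (symProd (H := H)))).topologicalClosure = ⊤ := by
  let L : PreFock H →ₗ[ℂ] Fock H :=
    (UniformSpace.Completion.toComplL (𝕜 := ℂ) (E := PreFock H)).toLinearMap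
  have hL : LinearMap.range L ≤ Submodule.span ℂ (Set.range (symProd (H := H))) := by
    rintro _ ⟨f, rfl⟩
    change List H →₀ ℂ at f
    induction f using Finsupp.induction_linear with
    | zero => exact (map_zero L).symm ▸ Submodule.zero_mem _
    | add f g hf hg => exact (map_add L f g).symm ▸ Submodule.add_mem _ hf hg
    | single u a =>
      have e : (Finsupp.single u a : List H →₀ ℂ) = a • Finsupp.single u 1 := by simp
      rw [e]
      exact (L.map_smul a (Finsupp.single u (1 : ℂ) : List H →₀ ℂ)).symm ▸
        Submodule.smul_mem _ _ (Submodule.subset_span ⟨u, rfl⟩)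
  rw [← top_le_iff]
  intro x _
  refine Submodule.topologicalClosure_mono hL ?_
  exact (UniformSpace.Completion.denseRange_coe (α := PreFock H)) x

/-- The `n`-particle subspace: the closed span of the symmetric products of `n` vectors. -/
def particleSpace (H : Type u) [NormedAddCommGroup H] [InnerProductSpace ℂ H] (n : ℕ) :
    Submodule ℂ (Fock H) :=
  (Submodule.span ℂ (symProd '' {u : List H | u.length = n})).topologicalClosure

instance instCompleteSpaceParticleSpace (n : ℕ) : CompleteSpace (particleSpace H n) :=
  (Submodule.isClosed_topologicalClosure _).completeSpace_coe

/-- The orthogonal projection onto the `n`-particle subspace. -/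
def particleProj (H : Type u) [NormedAddCommGroup H] [InnerProductSpace ℂ H] (n : ℕ) :
    Fock H →L[ℂ] Fock H :=
  (particleSpace H n).starProjection

/-- The graph of the number operator `n̂ = ∑ₙ n Pₙ`, an unbounded self-adjoint operator: `(ψ, φ)` is
in it if and only if `ψ` is in the domain of `n̂` and `n̂ ψ = φ`. -/
def numberGraph (H : Type u) [NormedAddCommGroup H] [InnerProductSpace ℂ H] :
    Set (Fock H × Fock H) :=
  {p | ∀ n : ℕ, particleProj H n p.2 = (n : ℂ) • particleProj H n p.1}

/-- The bounded operator `A` commutes with the number operator: for `ψ` in the domain of `n̂` also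
`A ψ` is in the domain of `n̂`, and `n̂ A ψ = A n̂ ψ`. -/
def CommutesWithNumber (A : Fock H →L[ℂ] Fock H) : Prop :=
  ∀ ψ φ : Fock H, (ψ, φ) ∈ numberGraph H → (A ψ, A φ) ∈ numberGraph H

/-- The average particle number `Tr(n̂ Δ) = ∑ₙ n Tr(Pₙ Δ Pₙ) ∈ [0, ∞]`. -/
def meanNumber (Δ : DensityOperator (Fock H)) : ℝ≥0∞ :=
  ∑' n : ℕ, (n : ℝ≥0∞) * posTrace (particleProj H n ∘L Δ.op ∘L particleProj H n)

/-- The Fock basis vector `|𝔫⟩` relative to an orthonormal basis `f` of `H`, for an occupation list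
`𝔫` with finitely many particles: the symmetric product with `𝔫 i` factors `f i`, for all `i`, divided
by its norm `√(∏ᵢ (𝔫 i)!)`. (Symmetric products do not depend on the order of the factors.) -/
def fockVec {ι : Type u} (f : HilbertBasis ι ℂ H) (n : ι →₀ ℕ) : Fock H :=
  ((√(n.prod fun _ k => (k.factorial : ℝ)) : ℝ) : ℂ)⁻¹ •
    symProd ((Finsupp.toMultiset n).toList.map f)

/-- Free density operators on the boson Fock space:
`Γ = ∑_𝔫 (∏ᵢ (1 - zᵢ) zᵢ ^ 𝔫(i)) |𝔫⟩⟨𝔫|` with `zᵢ ∈ [0, 1)`, `∑ᵢ zᵢ < ∞`, for the Fock basis relative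
to some orthonormal basis of `H`. -/
def IsFree (Γ : DensityOperator (Fock H)) : Prop :=
  ∃ (ι : Type u) (f : HilbertBasis ι ℂ H) (z : ι → ℝ),
    (∀ i, 0 ≤ z i ∧ z i < 1) ∧ Summable z ∧
    ∀ ψ : Fock H,
      HasSum (fun n : ι →₀ ℕ =>
        (((∏' i, ((1 - z i) * z i ^ n i) : ℝ) : ℂ) * ⟪fockVec f n, ψ⟫_ℂ) • fockVec f n) (Γ.op ψ)

/-- `γ` is the `1`-matrix of `Δ`: it is a bounded Hermitian operator on `H` and, for every orthonormal
basis `f` of `H`, `⟨fᵢ|γ|fᵢ⟩` is the average occupation `∑_𝔫 𝔫(i) ⟨𝔫|Δ|𝔫⟩` of the mode `fᵢ`. -/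
def IsOneMatrix [CompleteSpace H] (Δ : DensityOperator (Fock H)) (γ : H →L[ℂ] H) : Prop :=
  IsSelfAdjoint γ ∧ ∀ (ι : Type u) (f : HilbertBasis ι ℂ H) (i : ι),
    HasSum (fun n : ι →₀ ℕ => (n i : ℝ) * (⟪fockVec f n, Δ.op (fockVec f n)⟫_ℂ).re)
      (⟪f i, γ (f i)⟫_ℂ).re

/-- `γ = ∑ᵢ nᵢ |gᵢ⟩⟨gᵢ|` with an orthonormal system `g`: the `gᵢ` are natural modes and the `nᵢ`
are the natural occupation numbers. -/
def IsNaturalDecomposition (γ : H →L[ℂ] H) {ι : Type u} (g : ι → H) (n : ι → ℝ) : Prop :=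
  Orthonormal ℂ g ∧ ∀ h : H, HasSum (fun i => ((n i : ℂ) * ⟪g i, h⟫_ℂ) • g i) (γ h)

end FockSpace

end

end BosonFock

open BosonFock

/-! Everything reduces to a scalar inequality for one mode. The form `quadForm A u` = Tr(a(u) A
a*(u)) is a trace, hence basis-free; in the Fock basis of `f` its value at `f i` is the mean
occupation of that mode (`tsum_occupation`), and its sum over a basis is the mean particle number.
So Δ has a positive trace-class `1`-matrix γ (`exists_oneMatrix`), and γ has an eigenbasis g with
summable eigenvalues n_k. The candidate Γ_Δ is the free state over g with z_k = n_k/(1+n_k), the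
parameter at which a geometric distribution has mean n_k.

A free Γ with basis f and parameters z is diagonal in the Fock basis of f, and -log of its
eigenvalues is affine in the occupation numbers. Hence -Tr(Δ log Γ) = ∑_i [-log(1-z_i) - log z_i
⟨f_i|γ|f_i⟩], which depends on Δ only through γ. Expanding γ in g turns this into ∑_{i,k}
|⟨g_k,f_i⟩|² `modeCross` z_i n_k (`IsFreeWith.neg_traceLog_cross`). For fixed x, `modeCross` z x is
smallest, with value `modeEntropy` x, exactly at z = x/(1+x). As the weights sum to 1 over i, the
double sum is at least ∑_k `modeEntropy` n_k, the value for Γ_Δ.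

If equality holds and the sum is finite, then z_i = n_k/(1+n_k) whenever f_i and g_k overlap. The
one-particle operators K = ∑ z_i |f_i⟩⟨f_i| of the two free states then coincide, and K determines
the state: Γ a*(v) = a*(Kv) Γ, the vacuum is an eigenvector, and the trace fixes the constant
(`IsFreeWith.unique`). The same lemma shows that a free state is determined by its `1`-matrix.

Sums of nonnegative terms are mostly taken in `ℝ≥0∞`, where they may be interchanged freely and
infinite entropies need no separate treatment. -/

namespace BosonFock

open scoped ComplexOrder
open Filter Topology

/-! ### Traces of positive operators, compactness and eigenbases -/

section Trace

variable {E : Type u} [NormedAddCommGroup E] [InnerProductSpace ℂ E]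

theorem HilbertBasis.tsum_enorm_inner_sq {ι : Type*} (b : HilbertBasis ι ℂ E) (x : E) :
    ∑' i, ‖⟪b i, x⟫_ℂ‖ₑ ^ 2 = ‖x‖ₑ ^ 2 := by
  have h := (b.hasSum_inner_mul_inner x x)
  have h2 : HasSum (fun i => ‖⟪b i, x⟫_ℂ‖ ^ 2) (‖x‖ ^ 2) := by
    have h3 := Complex.hasSum_re h
    convert! h3 using 1
    · ext i
      rw [← inner_conj_symm x (b i), mul_comm, Complex.mul_conj, Complex.normSq_eq_norm_sq]
      norm_cast
    · rw [inner_self_eq_norm_sq_to_K]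
      norm_cast
  have h4 : ∀ i, ‖⟪b i, x⟫_ℂ‖ₑ ^ 2 = ENNReal.ofReal (‖⟪b i, x⟫_ℂ‖ ^ 2) := fun i => by
    rw [ENNReal.ofReal_pow (norm_nonneg _), ofReal_norm]
  rw [tsum_congr h4, ← ENNReal.ofReal_tsum_of_nonneg (fun i => sq_nonneg _) h2.summable,
    h2.tsum_eq, ENNReal.ofReal_pow (norm_nonneg _), ofReal_norm]

theorem ofReal_re_inner_self (x : E) : ENNReal.ofReal (⟪x, x⟫_ℂ).re = ‖x‖ₑ ^ 2 := by
  rw [← ofReal_norm, ← ENNReal.ofReal_pow (norm_nonneg _)]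
  congr 1
  rw [inner_self_eq_norm_sq_to_K]
  norm_cast

variable [CompleteSpace E]

theorem exists_hilbertBasis_mem {x : E} (hx : ‖x‖ = 1) :
    ∃ (w : Set E) (b : HilbertBasis w ℂ E) (i : w), b i = x := by
  have hs : Orthonormal ℂ ((↑) : ({x} : Set E) → E) := by
    refine ⟨fun i => ?_, fun i j hij => absurd (Subsingleton.elim i j) hij⟩
    rw [Set.mem_singleton_iff.1 i.2, hx]
  obtain ⟨w, b, hw, hb⟩ := hs.exists_hilbertBasis_extension
  exact ⟨w, b, ⟨x, hw rfl⟩, by rw [hb]⟩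

theorem exists_adjoint_comp_self {A : E →L[ℂ] E} (hA : A.IsPositive) :
    ∃ B : E →L[ℂ] E, A = B.adjoint ∘L B := by
  rw [← ContinuousLinearMap.nonneg_iff_isPositive] at hA
  exact CStarAlgebra.nonneg_iff_eq_star_mul_self.1 hA

theorem ofReal_re_inner_adjoint_comp {F : Type*} [NormedAddCommGroup F] [InnerProductSpace ℂ F]
    [CompleteSpace F] (B : E →L[ℂ] F) (x : E) :
    ENNReal.ofReal (⟪x, (B.adjoint ∘L B) x⟫_ℂ).re = ‖B x‖ₑ ^ 2 := by
  rw [ContinuousLinearMap.comp_apply, ContinuousLinearMap.adjoint_inner_right, ofReal_re_inner_self]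

/-- By Parseval both sides are the double sum of |⟨c k, B (b i)⟩|². Since the right side does not
see `b`, this yields the basis independence of the trace. -/
theorem tsum_enorm_sq_eq_adjoint {F : Type*} [NormedAddCommGroup F] [InnerProductSpace ℂ F]
    [CompleteSpace F] {ι κ : Type*} (b : HilbertBasis ι ℂ E) (c : HilbertBasis κ ℂ F)
    (B : E →L[ℂ] F) : ∑' i, ‖B (b i)‖ₑ ^ 2 = ∑' k, ‖B.adjoint (c k)‖ₑ ^ 2 := by
  simp_rw [← HilbertBasis.tsum_enorm_inner_sq c (B _), ← HilbertBasis.tsum_enorm_inner_sq b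
    (B.adjoint _)]
  rw [ENNReal.tsum_comm]
  refine tsum_congr fun k => tsum_congr fun i => ?_
  rw [ContinuousLinearMap.adjoint_inner_right, ← inner_conj_symm, RCLike.enorm_conj]

/-- The trace of a positive operator can be computed in any orthonormal basis. -/
theorem posTrace_eq {A : E →L[ℂ] E} (hA : A.IsPositive) {ι : Type*} (b : HilbertBasis ι ℂ E) :
    posTrace A = ∑' i, ENNReal.ofReal (⟪b i, A (b i)⟫_ℂ).re := by
  obtain ⟨B, rfl⟩ := exists_adjoint_comp_self hA
  obtain ⟨c, hc⟩ := (exists_hilbertBasis ℂ E).choose_spec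
  unfold posTrace
  simp_rw [ofReal_re_inner_adjoint_comp]
  rw [tsum_enorm_sq_eq_adjoint b c, ← tsum_enorm_sq_eq_adjoint c c]
  rw [hc]

/-- Write A = B*B. A unit vector y belongs to some orthonormal basis, so ‖B y‖² is one term of the
trace computed there; then ‖A‖ ≤ ‖B‖². -/
theorem enorm_le_posTrace {A : E →L[ℂ] E} (hA : A.IsPositive) : ‖A‖ₑ ≤ posTrace A := by
  have key : ∀ B : E →L[ℂ] E, A = B.adjoint ∘L B → ∀ x, ‖B x‖ₑ ^ 2 ≤ posTrace A * ‖x‖ₑ ^ 2 := by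
    rintro B rfl x
    rcases eq_or_ne x 0 with rfl | hx
    · simp
    have hx' : ‖x‖ ≠ 0 := norm_ne_zero_iff.2 hx
    set y : E := ((‖x‖⁻¹ : ℝ) : ℂ) • x with hy
    have hy1 : ‖y‖ = 1 := by
      rw [hy, norm_smul, Complex.norm_real, norm_inv, norm_norm, inv_mul_cancel₀ hx']
    have hxy : x = ((‖x‖ : ℝ) : ℂ) • y := by
      rw [hy, smul_smul, ← Complex.ofReal_mul, mul_inv_cancel₀ hx', Complex.ofReal_one, one_smul]
    obtain ⟨w, b, i, hbi⟩ := exists_hilbertBasis_mem hy1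
    have h1 : ‖B y‖ₑ ^ 2 ≤ posTrace (B.adjoint ∘L B) := by
      rw [posTrace_eq hA b, ← ofReal_re_inner_adjoint_comp, ← hbi]
      exact ENNReal.le_tsum (f := fun i => ENNReal.ofReal (⟪b i, (B.adjoint ∘L B) (b i)⟫_ℂ).re) i
    calc ‖B x‖ₑ ^ 2 = ‖B y‖ₑ ^ 2 * ‖x‖ₑ ^ 2 := by
          conv_lhs => rw [hxy]
          rw [map_smul, enorm_smul, mul_pow, mul_comm]
          congr 2
          rw [← ofReal_norm, Complex.norm_real, norm_norm, ofReal_norm]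
      _ ≤ _ := by gcongr
  rcases eq_or_ne (posTrace A) ⊤ with h | h
  · rw [h]; exact le_top
  obtain ⟨B, hB⟩ := exists_adjoint_comp_self hA
  have h2 : ‖B‖ ≤ √(posTrace A).toReal := by
    refine ContinuousLinearMap.opNorm_le_bound _ (Real.sqrt_nonneg _) fun x => ?_
    refine Real.le_sqrt_of_sq_le ?_ |>.trans_eq ?_ (b := √((posTrace A).toReal * ‖x‖ ^ 2))
    · have := ENNReal.toReal_mono (by finiteness) (key B hB x)
      simpa using this
    · rw [Real.sqrt_mul ENNReal.toReal_nonneg, Real.sqrt_sq (norm_nonneg _)]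
  have h3 : ‖A‖ ≤ (posTrace A).toReal := by
    rw [hB, ← hB]
    calc ‖A‖ ≤ ‖B.adjoint‖ * ‖B‖ := by
          conv_lhs => rw [hB]
          exact ContinuousLinearMap.opNorm_comp_le _ _
      _ = ‖B‖ ^ 2 := by rw [LinearIsometryEquiv.norm_map, sq]
      _ ≤ √(posTrace A).toReal ^ 2 := by gcongr
      _ = _ := Real.sq_sqrt ENNReal.toReal_nonneg
  rw [← ofReal_norm]
  exact ENNReal.ofReal_le_of_le_toReal h3

theorem enorm_comp_self_le {F : Type*} [NormedAddCommGroup F] [InnerProductSpace ℂ F]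
    [CompleteSpace F] {ι : Type*} (b : HilbertBasis ι ℂ E) (B : E →L[ℂ] F) :
    ‖B‖ₑ ^ 2 ≤ ∑' i, ‖B (b i)‖ₑ ^ 2 := by
  have h := enorm_le_posTrace (ContinuousLinearMap.isPositive_adjoint_comp_self B)
  rw [posTrace_eq (ContinuousLinearMap.isPositive_adjoint_comp_self B) b] at h
  simp_rw [ofReal_re_inner_adjoint_comp] at h
  refine le_trans ?_ h
  rw [← ofReal_norm, ← ofReal_norm, ← ENNReal.ofReal_pow (norm_nonneg _),
    ContinuousLinearMap.norm_adjoint_comp_self, sq]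

/-- With A = B*B, finite trace makes B Hilbert–Schmidt. The truncations of B to finitely many basis
vectors have finite rank and converge in norm, the error being bounded by a tail of the
Hilbert–Schmidt sum. -/
theorem isCompactOperator_of_posTrace_ne_top {A : E →L[ℂ] E} (hA : A.IsPositive)
    (h : posTrace A ≠ ⊤) : IsCompactOperator A := by
  classical
  obtain ⟨B, rfl⟩ := exists_adjoint_comp_self hA
  obtain ⟨w, b, -⟩ := exists_hilbertBasis ℂ E
  rw [posTrace_eq hA b] at h
  simp_rw [ofReal_re_inner_adjoint_comp] at h
  refine IsCompactOperator.clm_comp (f := B) ?_ B.adjoint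
  let F : Finset w → E →L[ℂ] E := fun s =>
    ∑ i ∈ s, InnerProductSpace.rankOne ℂ (B (b i)) (b i)
  have hF : ∀ s j, F s (b j) = if j ∈ s then B (b j) else 0 := by
    intro s j
    simp only [F, sum_apply, InnerProductSpace.rankOne_apply,
      orthonormal_iff_ite.1 b.orthonormal, ite_smul, one_smul, zero_smul, Finset.sum_ite_eq']
  have hle : ∀ s, ‖F s - B‖ₑ ^ 2 ≤ ∑' i : {i // i ∉ s}, ‖B (b i)‖ₑ ^ 2 := by
    intro s
    refine (enorm_comp_self_le b _).trans ?_
    refine le_of_le_of_eq ?_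
      (tsum_subtype {i | i ∉ s} (fun i => ‖B (b i)‖ₑ ^ 2)).symm
    refine ENNReal.tsum_le_tsum fun i => ?_
    rw [sub_apply, hF]
    by_cases hi : i ∈ s <;> simp [hi, Set.indicator]
  have hlim : Tendsto F atTop (𝓝 B) := by
    rw [tendsto_iff_edist_tendsto_0]
    simp_rw [edist_eq_enorm_sub]
    have h1 : Tendsto (fun s => ‖F s - B‖ₑ ^ 2) atTop (𝓝 0) :=
      tendsto_of_tendsto_of_tendsto_of_le_of_le tendsto_const_nhds
        (ENNReal.tendsto_tsum_compl_atTop_zero h) (fun _ => zero_le) hle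
    have h2 := h1.ennrpow_const (1 / 2 : ℝ)
    rw [ENNReal.zero_rpow_of_pos (by norm_num)] at h2
    refine h2.congr fun s => ?_
    rw [← ENNReal.rpow_natCast, ← ENNReal.rpow_mul]
    norm_num
  refine isCompactOperator_of_tendsto hlim (Eventually.of_forall fun s => ?_)
  have : ∀ s : Finset w, IsCompactOperator (F s) := by
    intro s
    induction s using Finset.induction_on with
    | empty => simpa [F] using (isCompactOperator_zero : IsCompactOperator (0 : E → E))
    | insert i s hi ih =>
      simp only [F, Finset.sum_insert hi]
      refine IsCompactOperator.add ?_ ih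
      have hfst : IsCompactOperator (innerSL ℂ (b i) : E →L[ℂ] ℂ) :=
        isCompactOperator_of_locallyCompactSpace_dom _
      exact hfst.clm_comp (ContinuousLinearMap.toSpanSingleton ℂ (B (b i)))
  exact this s

/-- A positive operator with finite trace has an orthonormal basis of eigenvectors. -/
theorem exists_hilbertBasis_eigenvectors {A : E →L[ℂ] E} (hA : A.IsPositive)
    (h : posTrace A ≠ ⊤) :
    ∃ (ι : Type u) (b : HilbertBasis ι ℂ E) (c : ι → ℝ), ∀ i, A (b i) = (c i : ℂ) • b i := by
  have hc := isCompactOperator_of_posTrace_ne_top hA h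
  have hbot := ContinuousLinearMap.orthogonalComplement_iSup_eigenspaces_eq_bot hc hA.isSymmetric
  let V : ℂ → Submodule ℂ E := fun μ => Module.End.eigenspace (A : Module.End ℂ E) μ
  have hcl : ∀ μ, IsClosed (V μ : Set E) := fun μ => by
    have : V μ = (A - μ • ContinuousLinearMap.id ℂ E).ker := by
      ext x
      simp [V, sub_eq_zero]
    rw [this]
    exact ContinuousLinearMap.isClosed_ker _
  have : ∀ μ, CompleteSpace (V μ) := fun μ => (hcl μ).completeSpace_coe
  choose w b hb using fun μ => exists_hilbertBasis ℂ (V μ)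
  have hV : OrthogonalFamily ℂ (fun μ => V μ) fun μ => (V μ).subtypeₗᵢ :=
    LinearMap.IsSymmetric.orthogonalFamily_eigenspaces hA.isSymmetric
  have hon := hV.orthonormal_sigma_orthonormal (v_family := fun μ i => b μ i)
    fun μ => (b μ).orthonormal
  have hperp : (Submodule.span ℂ (Set.range fun a : Σ μ, w μ =>
      (V a.1).subtypeₗᵢ (b a.1 a.2)))ᗮ = ⊥ := by
    rw [eq_bot_iff, ← hbot]
    intro x hx
    rw [← Submodule.iInf_orthogonal, Submodule.mem_iInf]
    intro μ
    rw [Submodule.mem_orthogonal]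
    intro y hy
    have hs := (((b μ).hasSum_repr ⟨y, hy⟩).mapL (V μ).subtypeL).mapL (innerSL ℂ x)
    have h0 : ⟪x, y⟫_ℂ = 0 := by
      refine hs.unique ?_
      convert! hasSum_zero using 1
      ext i
      have := Submodule.mem_orthogonal' _ _ |>.1 hx ((b μ i : V μ) : E)
        (Submodule.subset_span ⟨⟨μ, i⟩, rfl⟩)
      simp [this]
    rw [← inner_conj_symm, h0, map_zero]
  refine ⟨Σ μ, w μ, HilbertBasis.mkOfOrthogonalEqBot hon hperp, fun a => a.1.re, fun a => ?_⟩
  rw [HilbertBasis.coe_mkOfOrthogonalEqBot]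
  have h1 : A (b a.1 a.2) = a.1 • ((b a.1 a.2 : V a.1) : E) :=
    Module.End.mem_eigenspace_iff.1 (b a.1 a.2).2
  -- Eigenvalues of a symmetric operator are real, so taking real parts loses nothing.
  have h2 : ((a.1.re : ℝ) : ℂ) = a.1 := by
    have hn : ‖(b a.1 a.2 : E)‖ = 1 := (b a.1).orthonormal.1 a.2
    have h3 := hA.isSymmetric.conj_eigenvalue_eq_self (μ := a.1)
      (Module.End.hasEigenvalue_of_hasEigenvector
        (Module.End.hasEigenvector_iff.2 ⟨(b a.1 a.2).2, fun h0 => by simp [h0] at hn⟩))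
    exact Complex.conj_eq_iff_re.1 h3
  rw [h2]
  exact h1

end Trace

/-! ### Operators diagonal in an orthonormal basis -/

section Diagonal

variable {E : Type u} [NormedAddCommGroup E] [InnerProductSpace ℂ E]

theorem HilbertBasis.hasSum_inner_smul {ι : Type*} (b : HilbertBasis ι ℂ E) (x : E) :
    HasSum (fun i => ⟪b i, x⟫_ℂ • b i) x := by
  simpa only [b.repr_apply_apply] using b.hasSum_repr x

theorem HilbertBasis.clm_ext {ι F : Type*} [NormedAddCommGroup F] [NormedSpace ℂ F]
    (b : HilbertBasis ι ℂ E) {A B : E →L[ℂ] F} (h : ∀ i, A (b i) = B (b i)) : A = B := by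
  ext x
  refine ((HilbertBasis.hasSum_inner_smul b x).mapL A).unique ?_
  simpa only [map_smul, h] using (HilbertBasis.hasSum_inner_smul b x).mapL B

theorem HilbertBasis.inner_eq_ite {ι : Type*} [DecidableEq ι] (b : HilbertBasis ι ℂ E) (i j : ι) :
    ⟪b i, b j⟫_ℂ = if i = j then 1 else 0 :=
  orthonormal_iff_ite.1 b.orthonormal i j

theorem HilbertBasis.hasSum_diagonal {ι : Type*} (b : HilbertBasis ι ℂ E) {c : ι → ℝ}
    {A : E →L[ℂ] E} (h : ∀ i, A (b i) = (c i : ℂ) • b i) (x : E) :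
    HasSum (fun i => ((c i : ℂ) * ⟪b i, x⟫_ℂ) • b i) (A x) := by
  have h1 := (HilbertBasis.hasSum_inner_smul b x).mapL A
  simpa only [map_smul, h, smul_smul, mul_comm] using h1

theorem Orthonormal.apply_of_hasSum {ι : Type*} {b : ι → E} (hb : Orthonormal ℂ b)
    {c : ι → ℂ} {A : E →L[ℂ] E} (h : ∀ x, HasSum (fun i => (c i * ⟪b i, x⟫_ℂ) • b i) (A x))
    (i : ι) : A (b i) = c i • b i := by
  classical
  refine (h (b i)).unique ?_
  convert! hasSum_ite_eq i (c i • b i) using 1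
  ext j
  rw [orthonormal_iff_ite.1 hb]
  split_ifs with hj
  · rw [hj, mul_one]
  · simp

theorem ofReal_re_inner_diagonal {ι : Type*} (b : HilbertBasis ι ℂ E) {c : ι → ℝ} {A : E →L[ℂ] E}
    (h0 : ∀ i, 0 ≤ c i) (h : ∀ i, A (b i) = (c i : ℂ) • b i) (x : E) :
    ENNReal.ofReal (⟪x, A x⟫_ℂ).re = ∑' i, ENNReal.ofReal (c i) * ‖⟪b i, x⟫_ℂ‖ₑ ^ 2 := by
  have h1 := (HilbertBasis.hasSum_diagonal b h x).mapL (innerSL ℂ x)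
  have h2 : ∀ i, innerSL ℂ x (((c i : ℂ) * ⟪b i, x⟫_ℂ) • b i) =
      ((c i * ‖⟪b i, x⟫_ℂ‖ ^ 2 : ℝ) : ℂ) := fun i => by
    rw [innerSL_apply_apply, inner_smul_right, ← inner_conj_symm x (b i), mul_assoc,
      Complex.mul_conj, Complex.normSq_eq_norm_sq]
    push_cast
    rfl
  simp only [h2] at h1
  have h3 := Complex.hasSum_re h1
  simp only [Complex.ofReal_re, innerSL_apply_apply] at h3
  rw [← h3.tsum_eq, ENNReal.ofReal_tsum_of_nonneg (fun i => mul_nonneg (h0 i) (sq_nonneg _))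
    h3.summable]
  refine tsum_congr fun i => ?_
  rw [ENNReal.ofReal_mul (h0 i), ENNReal.ofReal_pow (norm_nonneg _), ofReal_norm]

theorem re_inner_diagonal_self {ι : Type*} (b : HilbertBasis ι ℂ E) {c : ι → ℝ} {A : E →L[ℂ] E}
    (h : ∀ i, A (b i) = (c i : ℂ) • b i) (i : ι) : (⟪b i, A (b i)⟫_ℂ).re = c i := by
  rw [h, inner_smul_right, inner_self_eq_norm_sq_to_K, b.orthonormal.1]
  simp

variable [CompleteSpace E]

theorem exists_diagonal {ι : Type*} (b : HilbertBasis ι ℂ E) {c : ι → ℝ} (h0 : ∀ i, 0 ≤ c i)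
    (hc : Summable c) :
    ∃ A : E →L[ℂ] E, A.IsPositive ∧ ∀ i, A (b i) = (c i : ℂ) • b i := by
  classical
  have hs : Summable fun i => (c i : ℂ) • InnerProductSpace.rankOne ℂ (b i) (b i) := by
    refine Summable.of_norm ?_
    refine hc.congr fun i => ?_
    rw [norm_smul, InnerProductSpace.norm_rankOne, b.orthonormal.1, Complex.norm_real,
      Real.norm_of_nonneg (h0 i)]
    ring
  obtain ⟨A, happ⟩ : ∃ A : E →L[ℂ] E, ∀ x,
      HasSum (fun i => (c i : ℂ) • ⟪b i, x⟫_ℂ • b i) (A x) :=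
    ⟨_, fun x => hs.hasSum.mapL (ContinuousLinearMap.apply ℂ E x)⟩
  refine ⟨A, ?_, Orthonormal.apply_of_hasSum b.orthonormal fun x => ?_⟩
  · rw [ContinuousLinearMap.isPositive_iff_complex]
    intro x
    have h1 := (happ x).mapL (innerSL ℂ x)
    have h2 : ∀ i, innerSL ℂ x ((c i : ℂ) • ⟪b i, x⟫_ℂ • b i) =
        ((c i * ‖⟪b i, x⟫_ℂ‖ ^ 2 : ℝ) : ℂ) := fun i => by
      rw [innerSL_apply_apply, inner_smul_right, inner_smul_right, ← inner_conj_symm x (b i),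
        Complex.mul_conj, Complex.normSq_eq_norm_sq]
      push_cast
      rfl
    simp only [h2] at h1
    have h3 := Complex.hasSum_re h1
    have h4 := Complex.hasSum_im h1
    simp only [Complex.ofReal_re, Complex.ofReal_im] at h3 h4
    have h5 := h3.nonneg fun i => mul_nonneg (h0 i) (sq_nonneg _)
    have h6 := h4.unique hasSum_zero
    rw [innerSL_apply_apply] at h5 h6
    rw [← inner_conj_symm, RCLike.re_eq_complex_re, Complex.conj_re]
    refine ⟨?_, h5⟩
    apply Complex.ext
    · rw [Complex.conj_re, Complex.ofReal_re]
    · rw [Complex.conj_im, h6, Complex.ofReal_im, neg_zero]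
  · simpa only [smul_smul] using happ x

theorem posTrace_diagonal {ι : Type*} (b : HilbertBasis ι ℂ E) {c : ι → ℝ} {A : E →L[ℂ] E}
    (hA : A.IsPositive) (h : ∀ i, A (b i) = (c i : ℂ) • b i) :
    posTrace A = ∑' i, ENNReal.ofReal (c i) := by
  rw [posTrace_eq hA b]
  exact tsum_congr fun i => by rw [re_inner_diagonal_self b h]

/-- The trace of `P A P`, for a projection `P` onto the span of part of an orthonormal basis. -/
theorem posTrace_conj_starProjection {ι : Type*} (b : HilbertBasis ι ℂ E)
    (U : Submodule ℂ E) [U.HasOrthogonalProjection] (p : ι → Prop) [DecidablePred p]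
    (hp : ∀ i, p i → b i ∈ U) (hn : ∀ i, ¬ p i → b i ∈ Uᗮ)
    {A : E →L[ℂ] E} (hA : A.IsPositive) :
    posTrace (U.starProjection ∘L A ∘L U.starProjection) =
      ∑' i, if p i then ENNReal.ofReal (⟪b i, A (b i)⟫_ℂ).re else 0 := by
  rw [posTrace_eq (hA.conj_starProjection U) b]
  refine tsum_congr fun i => ?_
  simp only [ContinuousLinearMap.comp_apply]
  split_ifs with h
  · rw [← Submodule.inner_starProjection_left_eq_right,
      Submodule.starProjection_eq_self_iff.2 (hp i h)]
  · rw [(Submodule.starProjection_apply_eq_zero_iff U).2 (hn i h)]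
    simp

/-- Each basis vector lies in the eigenspace of `c i` and is orthogonal to all others, so after
exchanging the sums exactly one real x contributes for each i. This turns the spectral definition of
Tr(Δ log Γ) into a sum over any eigenbasis. -/
theorem tsum_negLog_mul_posTrace {ι : Type*} (b : HilbertBasis ι ℂ E) {c : ι → ℝ}
    {Γ A : E →L[ℂ] E} (hA : A.IsPositive)
    (h : ∀ i, Γ (b i) = (c i : ℂ) • b i) :
    ∑' x : ℝ, negLog x * posTrace (eigenProj Γ x ∘L A ∘L eigenProj Γ x) =
      ∑' i, negLog (c i) * ENNReal.ofReal (⟪b i, A (b i)⟫_ℂ).re := by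
  classical
  have hk : ∀ x : ℝ, posTrace (eigenProj Γ x ∘L A ∘L eigenProj Γ x) =
      ∑' i, if c i = x then ENNReal.ofReal (⟪b i, A (b i)⟫_ℂ).re else 0 := by
    intro x
    refine posTrace_conj_starProjection b _ (fun i => c i = x) (fun i hi => ?_)
      (fun i hi => ?_) hA
    · simp [h, ← hi]
    · rw [Submodule.mem_orthogonal']
      intro y hy
      have hy' : Γ y = (x : ℂ) • y := by simpa [sub_eq_zero] using hy
      have h1 := (HilbertBasis.hasSum_diagonal b h y).mapL (innerSL ℂ (b i))
      have h2 : ⟪b i, Γ y⟫_ℂ = (c i : ℂ) * ⟪b i, y⟫_ℂ := by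
        refine h1.unique ?_
        convert! hasSum_ite_eq i ((c i : ℂ) * ⟪b i, y⟫_ℂ) using 1
        ext j
        rw [innerSL_apply_apply, inner_smul_right, HilbertBasis.inner_eq_ite]
        by_cases hj : j = i
        · simp [hj]
        · simp [hj, Ne.symm hj]
      rw [hy', inner_smul_right] at h2
      have h3 : ((c i : ℂ) - x) * ⟪b i, y⟫_ℂ = 0 := by rw [sub_mul, h2, sub_self]
      refine (mul_eq_zero.1 h3).resolve_left fun h4 => hi ?_
      exact_mod_cast sub_eq_zero.1 h4
  simp_rw [hk, ← ENNReal.tsum_mul_left]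
  rw [ENNReal.tsum_comm]
  refine tsum_congr fun i => ?_
  rw [tsum_eq_single (c i) fun x hx => by simp [hx.symm]]
  simp

/-- Unit vectors suffice by scaling, self-adjointness makes the quadratic forms real, and
polarization recovers the operators. -/
theorem eq_of_re_inner_eq {A B : E →L[ℂ] E} (hA : IsSelfAdjoint A) (hB : IsSelfAdjoint B)
    (h : ∀ x, ‖x‖ = 1 → (⟪x, A x⟫_ℂ).re = (⟪x, B x⟫_ℂ).re) : A = B := by
  have h1 : ∀ x, (⟪x, A x⟫_ℂ).re = (⟪x, B x⟫_ℂ).re := by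
    intro x
    rcases eq_or_ne x 0 with rfl | hx
    · simp
    have hx' : ‖x‖ ≠ 0 := norm_ne_zero_iff.2 hx
    have hy1 : ‖((‖x‖⁻¹ : ℝ) : ℂ) • x‖ = 1 := by
      rw [norm_smul, Complex.norm_real, norm_inv, norm_norm, inv_mul_cancel₀ hx']
    have := h _ hy1
    simp only [map_smul, inner_smul_left, inner_smul_right, Complex.conj_ofReal,
      Complex.re_ofReal_mul] at this
    simpa [hx'] using this
  have key : (A : E →ₗ[ℂ] E) = B := by
    rw [← ext_inner_map]
    intro x
    have hA' := hA.isSymmetric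
    have hB' := hB.isSymmetric
    apply Complex.ext
    · have := h1 x
      rwa [← inner_conj_symm, ← inner_conj_symm x (B x), Complex.conj_re, Complex.conj_re] at this
    · have e1 : (⟪A x, x⟫_ℂ).im = 0 := hA'.im_inner_apply_self x
      have e2 : (⟪B x, x⟫_ℂ).im = 0 := hB'.im_inner_apply_self x
      exact e1.trans e2.symm
  ext x
  exact congrArg (fun T : E →ₗ[ℂ] E => T x) key

end Diagonal

/-! ### Permanents of Gram matrices -/

section SymInner

variable {H : Type u} [NormedAddCommGroup H] [InnerProductSpace ℂ H]

/-- The permanent of the Gram matrix of two families of vectors. -/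
noncomputable def gramPerm {n m : ℕ} (f : Fin n → H) (g : Fin m → H) : ℂ :=
  ∑ σ : Fin n ≃ Fin m, ∏ i, ⟪f i, g (σ i)⟫_ℂ

theorem symInner_eq_gramPerm (u v : List H) {n m : ℕ} (hn : u.length = n) (hm : v.length = m) :
    symInner u v = gramPerm (fun i : Fin n => u[i]) (fun j : Fin m => v[j]) := by
  subst hn hm
  rfl

/-- Expansion of the permanent along its first row: a bijection σ corresponds to the pair of σ 0 and
the bijection induced between the remaining indices. -/
theorem gramPerm_succ {n m : ℕ} (f : Fin (n + 1) → H) (g : Fin (m + 1) → H) :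
    gramPerm f g = ∑ k, ⟪f 0, g k⟫_ℂ * gramPerm (fun i => f i.succ) (fun j => g (k.succAbove j)) := by
  let φ : Fin (m + 1) × (Fin n ≃ Fin m) → (Fin (n + 1) ≃ Fin (m + 1)) := fun p =>
    ((finSuccEquiv n).trans p.2.optionCongr).trans (finSuccEquiv' p.1).symm
  have h0 : ∀ p, φ p 0 = p.1 := fun p => by simp [φ]
  have hs : ∀ p i, φ p (Fin.succ i) = p.1.succAbove (p.2 i) := fun p i => by simp [φ]
  have hφ : Function.Bijective φ := by
    constructor
    · rintro ⟨k, τ⟩ ⟨k', τ'⟩ h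
      have hk : k = k' := by simpa [h0] using congrArg (fun σ => σ 0) h
      subst hk
      congr 1
      ext i : 1
      have := congrArg (fun σ => σ i.succ) h
      simpa [hs] using this
    · intro σ
      let e : Option (Fin n) ≃ Option (Fin m) :=
        ((finSuccEquiv n).symm.trans σ).trans (finSuccEquiv' (σ 0))
      have he : e none = none := by simp [e]
      refine ⟨(σ 0, Equiv.removeNone e), ?_⟩
      ext i : 1
      refine Fin.cases (h0 _) (fun i => ?_) i
      rw [hs]
      obtain ⟨j, hj⟩ : ∃ j, e (some i) = some j :=
        Option.ne_none_iff_exists'.1 fun h => by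
          rw [← he] at h
          exact Option.some_ne_none _ (e.injective h)
      have h1 := Equiv.removeNone_some e ⟨j, hj⟩
      have h2 : e (some i) = finSuccEquiv' (σ 0) (σ i.succ) := by simp [e]
      rw [h2] at h1
      exact (finSuccEquiv'_eq_some.1 h1.symm).symm
  rw [gramPerm, ← hφ.sum_comp, Fintype.sum_prod_type]
  refine Finset.sum_congr rfl fun k _ => ?_
  rw [gramPerm, Finset.mul_sum]
  refine Finset.sum_congr rfl fun τ _ => ?_
  rw [Fin.prod_univ_succ, h0]
  simp only [hs]

theorem symInner_eq_zero {u v : List H} (h : u.length ≠ v.length) : symInner u v = 0 :=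
  Finset.sum_eq_zero fun σ _ => absurd (by simpa using Fintype.card_congr σ) h

theorem symInner_cons_left (w : H) (u v : List H) :
    symInner (w :: u) v = ∑ k : Fin v.length, ⟪w, v[k]⟫_ℂ * symInner u (v.eraseIdx k) := by
  obtain ⟨m, hm⟩ | h0 : (∃ m, v.length = m + 1) ∨ v.length = 0 := by
    cases v with
    | nil => exact Or.inr rfl
    | cons a v => exact Or.inl ⟨v.length, rfl⟩
  · rw [symInner_eq_gramPerm (w :: u) v rfl hm, gramPerm_succ]
    refine Fintype.sum_equiv (finCongr hm.symm) _ _ fun k => ?_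
    have he : (v.eraseIdx (k : ℕ)).length = m := by
      rw [List.length_eraseIdx_of_lt (by omega)]
      omega
    rw [show v.eraseIdx ((finCongr hm.symm k : Fin v.length) : ℕ) = v.eraseIdx (k : ℕ) from rfl,
      symInner_eq_gramPerm u _ rfl he]
    congr 2
    ext j
    simp only [Fin.getElem_fin, List.getElem_eraseIdx]
    by_cases h : (j : ℕ) < k
    · simp [h, Fin.succAbove, Fin.lt_def]
    · simp [h, Fin.succAbove, Fin.lt_def]
  · have : v = [] := List.length_eq_zero_iff.1 h0
    subst this
    rw [symInner_eq_zero (by simp)]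
    exact (Finset.sum_eq_zero fun k _ => k.elim0).symm

/-- Induction on the permutation. Under a common head, conjugate symmetry moves the lists to the
left, where the row expansion reduces to their tails; a swap of two heads is absorbed by composing σ
with a transposition. -/
theorem symInner_perm_right {v v' : List H} (h : v.Perm v') :
    ∀ u : List H, symInner u v = symInner u v' := by
  have hstar : ∀ {v v' : List H}, (∀ u, symInner u v = symInner u v') →
      ∀ u, symInner v u = symInner v' u := fun h u => by
    rw [← star_symInner, h, star_symInner]
  induction h with
  | nil => exact fun _ => rfl
  | cons a _ ih =>
    intro u
    rw [← star_symInner, ← star_symInner (a :: _)]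
    congr 1
    rw [symInner_cons_left, symInner_cons_left]
    exact Finset.sum_congr rfl fun k _ => by rw [hstar ih]
  | swap a b l =>
    intro u
    refine Fintype.sum_equiv
      ⟨fun σ => σ.trans (Equiv.swap (0 : Fin (l.length + 2)) 1),
        fun σ => σ.trans (Equiv.swap (0 : Fin (l.length + 2)) 1),
        fun σ => by ext i; simp, fun σ => by ext i; simp⟩ _ _ fun σ => ?_
    refine Finset.prod_congr rfl fun i _ => ?_
    congr 1
    change (b :: a :: l).get (σ i) = (a :: b :: l).get (Equiv.swap (0 : Fin (l.length + 2)) 1 (σ i))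
    generalize σ i = j
    change Fin (l.length + 2) at j
    refine Fin.cases ?_ (fun j => Fin.cases ?_ (fun j => ?_) j) j
    · simp
    · change _ = (a :: b :: l).get (Equiv.swap (0 : Fin (l.length + 2)) 1 1)
      rw [Equiv.swap_apply_right]
      rfl
    · rw [Equiv.swap_apply_of_ne_of_ne (by simp) (by simp [Fin.ext_iff])]
      rfl
  | trans _ _ ih1 ih2 => exact fun u => (ih1 u).trans (ih2 u)

end SymInner

/-! ### Symmetric products are total, symmetric and multilinear -/

section Fock

variable {H : Type u} [NormedAddCommGroup H] [InnerProductSpace ℂ H]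

theorem eq_of_inner_symProd {x y : Fock H} (h : ∀ u, ⟪symProd u, x⟫_ℂ = ⟪symProd u, y⟫_ℂ) :
    x = y := by
  rw [← sub_eq_zero]
  have hx : x - y ∈ (Submodule.span ℂ (Set.range (symProd (H := H))))ᗮ := by
    rw [Submodule.mem_orthogonal]
    intro z hz
    induction hz using Submodule.span_induction with
    | mem z hz => obtain ⟨u, rfl⟩ := hz; rw [inner_sub_right, h, sub_self]
    | zero => simp
    | add a b _ _ ha hb => rw [inner_add_left, ha, hb, add_zero]
    | smul c a _ ha => rw [inner_smul_left, ha, mul_zero]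
  rw [← Submodule.orthogonal_closure, dense_span_symProd, Submodule.top_orthogonal_eq_bot] at hx
  exact hx

theorem fock_clm_ext {F : Type*} [NormedAddCommGroup F] [NormedSpace ℂ F]
    {A B : Fock H →L[ℂ] F} (h : ∀ u, A (symProd u) = B (symProd u)) : A = B := by
  refine ContinuousLinearMap.ext_on (s := Set.range (symProd (H := H))) ?_ ?_
  · rw [dense_iff_closure_eq, ← Submodule.topologicalClosure_coe, dense_span_symProd]
    rfl
  · rintro _ ⟨u, rfl⟩
    exact h u

theorem symProd_perm {v v' : List H} (h : v.Perm v') : symProd v = symProd v' :=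
  eq_of_inner_symProd fun u => by rw [inner_symProd, inner_symProd, symInner_perm_right h]

theorem symProd_cons_add (a b : H) (l : List H) :
    symProd ((a + b) :: l) = symProd (a :: l) + symProd (b :: l) := by
  refine eq_of_inner_symProd fun u => ?_
  rw [inner_add_right]
  simp only [inner_symProd]
  rw [← star_symInner, ← star_symInner (a :: l), ← star_symInner (b :: l), ← star_add]
  simp only [symInner_cons_left, inner_add_left, add_mul, Finset.sum_add_distrib]

theorem symProd_cons_smul (c : ℂ) (a : H) (l : List H) :
    symProd ((c • a) :: l) = c • symProd (a :: l) := by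
  refine eq_of_inner_symProd fun u => ?_
  rw [inner_smul_right]
  simp only [inner_symProd]
  rw [← star_symInner, ← star_symInner (a :: l)]
  simp only [symInner_cons_left, inner_smul_left, mul_assoc]
  rw [← Finset.mul_sum]
  simp

end Fock

/-! ### Creation and annihilation on formal linear combinations -/

noncomputable section Creation

variable {H : Type u} [NormedAddCommGroup H] [InnerProductSpace ℂ H]

/-- The vector of the Fock space given by a formal linear combination of symmetric products. -/
def linSym : (List H →₀ ℂ) →ₗ[ℂ] Fock H := Finsupp.linearCombination ℂ symProd

/-- Creation on formal linear combinations of symmetric products. -/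
def preCreate (u : H) : (List H →₀ ℂ) →ₗ[ℂ] (List H →₀ ℂ) :=
  Finsupp.linearCombination ℂ fun l => Finsupp.single (u :: l) 1

/-- Annihilation on formal linear combinations of symmetric products. -/
def preAnnihilate (u : H) : (List H →₀ ℂ) →ₗ[ℂ] (List H →₀ ℂ) :=
  Finsupp.linearCombination ℂ fun l =>
    ∑ k : Fin l.length, ⟪u, l[k]⟫_ℂ • Finsupp.single (l.eraseIdx k) (1 : ℂ)

/-- Restriction of a formal linear combination to products of `N` factors. -/
def preSector (N : ℕ) : (List H →₀ ℂ) →ₗ[ℂ] (List H →₀ ℂ) :=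
  Finsupp.linearCombination ℂ fun l => if l.length = N then Finsupp.single l 1 else 0

theorem linSym_single (l : List H) : linSym (Finsupp.single l 1) = symProd l := by
  simp [linSym]

omit [NormedAddCommGroup H] [InnerProductSpace ℂ H] in
theorem preCreate_single (u : H) (l : List H) :
    preCreate u (Finsupp.single l 1) = Finsupp.single (u :: l) 1 := by
  simp [preCreate]

theorem preAnnihilate_single (u : H) (l : List H) :
    preAnnihilate u (Finsupp.single l 1) =
      ∑ k : Fin l.length, ⟪u, l[k]⟫_ℂ • Finsupp.single (l.eraseIdx k) (1 : ℂ) := by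
  simp [preAnnihilate]

omit [NormedAddCommGroup H] [InnerProductSpace ℂ H] in
theorem preSector_single (N : ℕ) (l : List H) :
    preSector N (Finsupp.single l 1) = if l.length = N then Finsupp.single l 1 else 0 := by
  simp [preSector]

omit [NormedAddCommGroup H] [InnerProductSpace ℂ H] in
theorem finsupp_linear_induction {p : (List H →₀ ℂ) → Prop} (h0 : p 0)
    (hadd : ∀ f g, p f → p g → p (f + g)) (hsmul : ∀ (c : ℂ) f, p f → p (c • f))
    (hs : ∀ l, p (Finsupp.single l 1)) (f : List H →₀ ℂ) : p f := by
  induction f using Finsupp.induction_linear with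
  | zero => exact h0
  | add f g hf hg => exact hadd f g hf hg
  | single l a => simpa using hsmul a _ (hs l)

/-- Two sesquilinear expressions in formal linear combinations agree if they agree on symmetric
products. -/
theorem inner_eq_of_single {A B C D : (List H →₀ ℂ) →ₗ[ℂ] Fock H}
    (h : ∀ l m, ⟪A (Finsupp.single l 1), B (Finsupp.single m 1)⟫_ℂ =
      ⟪C (Finsupp.single l 1), D (Finsupp.single m 1)⟫_ℂ) (f g : List H →₀ ℂ) :
    ⟪A f, B g⟫_ℂ = ⟪C f, D g⟫_ℂ := by
  induction f using finsupp_linear_induction with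
  | h0 => simp
  | hadd f f' hf hf' => simp only [map_add, inner_add_left, hf, hf']
  | hsmul c f hf => simp only [map_smul, inner_smul_left, hf]
  | hs l =>
    induction g using finsupp_linear_induction with
    | h0 => simp
    | hadd f f' hf hf' => simp only [map_add, inner_add_right, hf, hf']
    | hsmul c f hf => simp only [map_smul, inner_smul_right, hf]
    | hs m => exact h l m

/-- Creation and annihilation are formal adjoints: this is the expansion of the permanent along the
added factor. Formal combinations are used because symmetric products satisfy linear relations, and
only the later norm bound shows that creation respects them. -/
theorem inner_preCreate (u : H) (f g : List H →₀ ℂ) :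
    ⟪linSym (preCreate u f), linSym g⟫_ℂ = ⟪linSym f, linSym (preAnnihilate u g)⟫_ℂ := by
  refine inner_eq_of_single (A := linSym ∘ₗ preCreate u) (D := linSym ∘ₗ preAnnihilate u)
    (fun l m => ?_) f g
  simp only [LinearMap.comp_apply, preCreate_single, preAnnihilate_single, linSym_single,
    map_sum, map_smul, inner_symProd, inner_sum, inner_smul_right, symInner_cons_left]

/-- The canonical commutation relation: annihilation removes either the factor just added or one of
the old ones. -/
theorem preAnnihilate_preCreate (u v : H) (f : List H →₀ ℂ) :
    preAnnihilate u (preCreate v f) = ⟪u, v⟫_ℂ • f + preCreate v (preAnnihilate u f) := by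
  induction f using finsupp_linear_induction with
  | h0 => simp
  | hadd f f' hf hf' => simp only [map_add, hf, hf', smul_add]; abel
  | hsmul c f hf => simp only [map_smul, hf, smul_add, smul_comm c]
  | hs l =>
    rw [preCreate_single, preAnnihilate_single, preAnnihilate_single, map_sum]
    change ∑ k : Fin (l.length + 1), _ = _
    rw [Fin.sum_univ_succ]
    simp only [map_smul, preCreate_single]
    rfl

/-- Formal linear combinations of symmetric products of `N` factors. -/
def IsSector (N : ℕ) (f : List H →₀ ℂ) : Prop := preSector N f = f

omit [NormedAddCommGroup H] [InnerProductSpace ℂ H] in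
theorem preSector_preSector (N : ℕ) (f : List H →₀ ℂ) : IsSector N (preSector N f) := by
  unfold IsSector
  induction f using finsupp_linear_induction with
  | h0 => simp
  | hadd f f' hf hf' => simp only [map_add, hf, hf']
  | hsmul c f hf => simp only [map_smul, hf]
  | hs l =>
    rw [preSector_single]
    split_ifs with h
    · rw [preSector_single, if_pos h]
    · simp

theorem preSector_preAnnihilate (N : ℕ) (u : H) (f : List H →₀ ℂ) :
    preSector N (preAnnihilate u f) = preAnnihilate u (preSector (N + 1) f) := by
  induction f using finsupp_linear_induction with
  | h0 => simp
  | hadd f f' hf hf' => simp only [map_add, hf, hf']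
  | hsmul c f hf => simp only [map_smul, hf]
  | hs l =>
    rw [preAnnihilate_single, preSector_single, map_sum]
    simp only [map_smul, preSector_single]
    split_ifs with h
    · rw [preAnnihilate_single]
      refine Finset.sum_congr rfl fun k _ => ?_
      rw [if_pos]
      rw [List.length_eraseIdx_of_lt k.2]
      omega
    · rw [map_zero]
      refine Finset.sum_eq_zero fun k _ => ?_
      rw [if_neg, smul_zero]
      rw [List.length_eraseIdx_of_lt k.2]
      have := k.2
      omega

theorem preAnnihilate_preSector_zero (u : H) (f : List H →₀ ℂ) :
    preAnnihilate u (preSector 0 f) = 0 := by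
  induction f using finsupp_linear_induction with
  | h0 => simp
  | hadd f f' hf hf' => simp only [map_add, hf, hf', add_zero]
  | hsmul c f hf => simp only [map_smul, hf, smul_zero]
  | hs l =>
    rw [preSector_single]
    split_ifs with h
    · rw [List.length_eq_zero_iff] at h
      subst h
      rw [preAnnihilate_single]
      exact Finset.sum_eq_zero fun k _ => k.elim0
    · simp

theorem norm_sq_linSym_preCreate (u : H) (f : List H →₀ ℂ) :
    ‖linSym (preCreate u f)‖ ^ 2 =
      ‖u‖ ^ 2 * ‖linSym f‖ ^ 2 + ‖linSym (preAnnihilate u f)‖ ^ 2 := by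
  have h : ⟪linSym (preCreate u f), linSym (preCreate u f)⟫_ℂ =
      ⟪u, u⟫_ℂ * ⟪linSym f, linSym f⟫_ℂ +
        ⟪linSym (preAnnihilate u f), linSym (preAnnihilate u f)⟫_ℂ := by
    rw [inner_preCreate, preAnnihilate_preCreate, map_add, inner_add_right, map_smul,
      inner_smul_right]
    congr 1
    rw [← inner_conj_symm, inner_preCreate, inner_conj_symm]
  simp only [inner_self_eq_norm_sq_to_K] at h
  exact_mod_cast h

/-- Induction on the particle number. By adjointness ‖a(u)f‖² ≤ ‖a*(u)a(u)f‖ ‖f‖, and a(u)f has one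
particle fewer, so the induction hypothesis bounds ‖a(u)f‖²; the commutation relation then adds one
more ‖u‖²‖f‖². -/
theorem norm_sq_linSym_preCreate_le (u : H) (N : ℕ) :
    ∀ f : List H →₀ ℂ, IsSector N f →
      ‖linSym (preCreate u f)‖ ^ 2 ≤ (N + 1) * ‖u‖ ^ 2 * ‖linSym f‖ ^ 2 := by
  induction N with
  | zero =>
    intro f hf
    rw [norm_sq_linSym_preCreate, ← hf, preAnnihilate_preSector_zero]
    simp
  | succ N ih =>
    intro f hf
    have hg : IsSector N (preAnnihilate u f) := by
      unfold IsSector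
      rw [preSector_preAnnihilate, hf]
    have h1 := ih _ hg
    have h2 : ‖linSym (preAnnihilate u f)‖ ^ 2 ≤
        ‖linSym (preCreate u (preAnnihilate u f))‖ * ‖linSym f‖ := by
      have h := inner_preCreate u (preAnnihilate u f) f
      have h' := norm_inner_le_norm (𝕜 := ℂ) (linSym (preCreate u (preAnnihilate u f))) (linSym f)
      rw [h, inner_self_eq_norm_sq_to_K] at h'
      simpa using h'
    rw [norm_sq_linSym_preCreate]
    set a := ‖linSym (preAnnihilate u f)‖
    set c := ‖linSym (preCreate u (preAnnihilate u f))‖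
    set b := ‖linSym f‖
    have ha : 0 ≤ a := norm_nonneg _
    -- Squaring a² ≤ c b and inserting the bound on c leaves a common factor a², cancelled unless a
    -- = 0.
    have h3 : a ^ 2 ≤ (N + 1) * ‖u‖ ^ 2 * b ^ 2 := by
      rcases ha.eq_or_lt with h0 | h0
      · rw [← h0, zero_pow two_ne_zero]; positivity
      · have h4 : (a ^ 2) ^ 2 ≤ (c * b) ^ 2 := by gcongr
        have h5 : (c * b) ^ 2 ≤ ((N + 1) * ‖u‖ ^ 2 * a ^ 2) * b ^ 2 := by
          rw [mul_pow]; gcongr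
        have h6 : a ^ 2 * a ^ 2 ≤ ((N + 1) * ‖u‖ ^ 2 * b ^ 2) * a ^ 2 := by
          calc _ = (a ^ 2) ^ 2 := by ring
            _ ≤ _ := h4.trans h5
            _ = _ := by ring
        exact le_of_mul_le_mul_right h6 (by positivity)
    push_cast
    linarith

/-- Products of different lengths are orthogonal, so ‖Pf‖² = ⟨Pf, f⟩ for the restriction P, and
Cauchy–Schwarz gives a contraction. -/
theorem norm_linSym_preSector_le (N : ℕ) (f : List H →₀ ℂ) :
    ‖linSym (preSector N f)‖ ≤ ‖linSym f‖ := by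
  have h := inner_eq_of_single (A := linSym ∘ₗ preSector N) (B := linSym ∘ₗ preSector N)
    (C := linSym ∘ₗ preSector N) (D := linSym) (fun l m => ?_) f f
  · simp only [LinearMap.comp_apply] at h
    rw [inner_self_eq_norm_sq_to_K] at h
    have h' := norm_inner_le_norm (𝕜 := ℂ) (linSym (preSector N f)) (linSym f)
    rw [← h] at h'
    simp only [norm_pow, RCLike.norm_ofReal, abs_norm] at h'
    rcases (norm_nonneg (linSym (preSector N f))).eq_or_lt with h0 | h0
    · rw [← h0]; positivity
    · rw [sq] at h'
      exact le_of_mul_le_mul_left h' h0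
  · simp only [LinearMap.comp_apply, preSector_single]
    split_ifs with h1 h2 h2
    · rfl
    · rw [map_zero, inner_zero_right, linSym_single, linSym_single, inner_symProd,
        symInner_eq_zero (by omega)]
    · simp
    · simp

theorem norm_linSym_preCreate_preSector_le (u : H) (N : ℕ) (f : List H →₀ ℂ) :
    ‖linSym (preCreate u (preSector N f))‖ ≤ √(N + 1) * ‖u‖ * ‖linSym f‖ := by
  have h1 := norm_sq_linSym_preCreate_le u N _ (preSector_preSector N f)
  have h2 : ‖linSym (preCreate u (preSector N f))‖ ^ 2 ≤ (√(N + 1) * ‖u‖ * ‖linSym f‖) ^ 2 := by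
    refine h1.trans ?_
    rw [mul_pow, mul_pow, Real.sq_sqrt (by positivity)]
    gcongr
    exact norm_linSym_preSector_le N f
  exact (sq_le_sq₀ (norm_nonneg _) (by positivity)).1 h2

theorem denseRange_linSym : DenseRange (linSym (H := H)) := by
  have h : (LinearMap.range (linSym (H := H))).topologicalClosure = ⊤ := by
    rw [linSym, Finsupp.range_linearCombination, dense_span_symProd]
  rw [DenseRange, dense_iff_closure_eq, ← LinearMap.coe_range, ← Submodule.topologicalClosure_coe,
    h]
  rfl

end Creation

/-! ### Bounded creation operators on each particle sector -/

noncomputable section Create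

variable {H : Type u} [NormedAddCommGroup H] [InnerProductSpace ℂ H]

/-- Creation on the `N`-particle sector, as a bounded operator. -/
def createAux (N : ℕ) (u : H) : Fock H →L[ℂ] Fock H :=
  (linSym ∘ₗ preCreate u ∘ₗ preSector N).extendOfNorm linSym

/-- The sector bound guarantees that `extendOfNorm` really extends formal creation; it also makes
creation well defined modulo null vectors. -/
theorem createAux_symProd (N : ℕ) (u : H) (l : List H) :
    createAux N u (symProd l) = if l.length = N then symProd (u :: l) else 0 := by
  rw [← linSym_single, createAux, LinearMap.extendOfNorm_eq denseRange_linSym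
    ⟨_, norm_linSym_preCreate_preSector_le u N⟩]
  simp only [LinearMap.comp_apply, preSector_single]
  split_ifs with h
  · rw [preCreate_single, linSym_single]
  · simp

theorem norm_createAux_le (N : ℕ) (u : H) : ‖createAux N u‖ ≤ √(N + 1) * ‖u‖ :=
  LinearMap.opNorm_extendOfNorm_le denseRange_linSym (by positivity)
    (norm_linSym_preCreate_preSector_le u N)

/-- The operator `a*(u)`, restricted to the `N`-particle sector (and zero on the others), as a
continuous linear function of `u`. -/
def create (N : ℕ) : H →L[ℂ] Fock H →L[ℂ] Fock H :=
  LinearMap.mkContinuous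
    { toFun := createAux N
      map_add' := fun a b => fock_clm_ext fun l => by
        simp only [add_apply, createAux_symProd, symProd_cons_add]
        split_ifs <;> simp
      map_smul' := fun c a => fock_clm_ext fun l => by
        simp only [smul_apply, createAux_symProd, symProd_cons_smul, RingHom.id_apply]
        split_ifs <;> simp } (√(N + 1)) (norm_createAux_le N)

theorem create_symProd (N : ℕ) (u : H) (l : List H) :
    create N u (symProd l) = if l.length = N then symProd (u :: l) else 0 :=
  createAux_symProd N u l

end Create

/-! ### The Fock basis -/

noncomputable section Basis

variable {H : Type u} [NormedAddCommGroup H] [InnerProductSpace ℂ H] {ι : Type u}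
  (f : HilbertBasis ι ℂ H)

/-- The (not normalized) symmetric product with `n i` factors `f i`. -/
def occVec (n : ι →₀ ℕ) : Fock H := symProd ((Finsupp.toMultiset n).toList.map f)

theorem symProd_map_eq_occVec (L : List ι) [DecidableEq ι] :
    symProd (L.map f) = occVec f (Multiset.toFinsupp (L : Multiset ι)) := by
  refine symProd_perm (List.Perm.map _ ?_)
  rw [← Multiset.coe_eq_coe, Multiset.coe_toList]
  simp

theorem length_toList_map (n : ι →₀ ℕ) :
    ((Finsupp.toMultiset n).toList.map f).length = n.degree := by
  rw [List.length_map, Multiset.length_toList, Finsupp.card_toMultiset]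
  rfl

theorem symProd_cons_occVec (i : ι) (n : ι →₀ ℕ) :
    symProd (f i :: (Finsupp.toMultiset n).toList.map f) = occVec f (n + Finsupp.single i 1) := by
  rw [← List.map_cons (f := f)]
  refine symProd_perm (List.Perm.map _ ?_)
  rw [← Multiset.coe_eq_coe, Multiset.coe_toList, ← Multiset.cons_coe, Multiset.coe_toList,
    map_add, Finsupp.toMultiset_single, one_smul, add_comm, Multiset.singleton_add]

theorem create_occVec (N : ℕ) (i : ι) (n : ι →₀ ℕ) :
    create N (f i) (occVec f n) = if n.degree = N then occVec f (n + Finsupp.single i 1) else 0 := by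
  rw [occVec, create_symProd, length_toList_map, symProd_cons_occVec]

/-- In the row expansion only positions of L holding i survive. Erasing any of them leaves the same
list up to permutation, and there are `L.count i` of them. -/
theorem symInner_cons_basis [DecidableEq ι] (i : ι) (u : List H) (L : List ι) :
    symInner (f i :: u) (L.map f) = (L.count i : ℂ) * symInner u ((L.erase i).map f) := by
  rw [symInner_cons_left]
  have hterm : ∀ k : Fin (L.map f).length,
      ⟪f i, (L.map f)[k]⟫_ℂ * symInner u ((L.map f).eraseIdx k) =
        if i = L[(k : ℕ)]'(by simpa using k.2) then symInner u ((L.erase i).map f) else 0 := by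
    intro k
    have hk : (k : ℕ) < L.length := by simpa using k.2
    rw [Fin.getElem_fin, List.getElem_map, HilbertBasis.inner_eq_ite]
    split_ifs with h
    · rw [one_mul]
      refine symInner_perm_right ?_ u
      rw [List.eraseIdx_map]
      refine List.Perm.map _ ?_
      have h1 : L.Perm (i :: L.eraseIdx k) := by
        conv_lhs => rw [← List.insertIdx_eraseIdx_getElem hk]
        rw [h]
        exact List.perm_insertIdx _ _ (by rw [List.length_eraseIdx_of_lt hk]; omega)
      have h2 : L.Perm (i :: L.erase i) := List.perm_cons_erase (h ▸ List.getElem_mem hk)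
      exact (h1.symm.trans h2).cons_inv
    · rw [zero_mul]
  rw [Finset.sum_congr rfl fun k _ => hterm k]
  have hlen : (L.map f).length = L.length := by simp
  refine (Fintype.sum_equiv (finCongr hlen) _
    (fun k : Fin L.length => if i = L[(k : ℕ)] then symInner u ((L.erase i).map f) else 0)
    (fun k => rfl)).trans ?_
  rw [← Finset.sum_filter, Finset.sum_const, nsmul_eq_mul]
  congr 2
  have h := Fin.card_filter_univ_eq_vector_get_eq_count i ⟨L, rfl⟩
  simpa only [eq_comm (a := i)] using! h

/-- The action of a(f i) on an occupation vector. Truncated subtraction is harmless: when `m i = 0`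
the prefactor vanishes. -/
theorem inner_occVec_add_single (i : ι) (n m : ι →₀ ℕ) :
    ⟪occVec f (n + Finsupp.single i 1), occVec f m⟫_ℂ =
      (m i : ℂ) * ⟪occVec f n, occVec f (m - Finsupp.single i 1)⟫_ℂ := by
  classical
  rw [← symProd_cons_occVec]
  have h : occVec f (m - Finsupp.single i 1) =
      symProd (((Finsupp.toMultiset m).toList.erase i).map f) := by
    rw [symProd_map_eq_occVec, ← Multiset.coe_erase, Multiset.coe_toList]
    congr 1
    ext j
    rw [Multiset.toFinsupp_apply, Finsupp.tsub_apply]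
    by_cases hj : j = i
    · subst hj
      rw [Multiset.count_erase_self, Finsupp.count_toMultiset, Finsupp.single_eq_same]
    · rw [Multiset.count_erase_of_ne hj, Finsupp.count_toMultiset, Finsupp.single_eq_of_ne hj,
        Nat.sub_zero]
  rw [h]
  simp only [occVec, inner_symProd]
  rw [symInner_cons_basis, ← Multiset.coe_count, Multiset.coe_toList, Finsupp.count_toMultiset]

/-- The squared norm of `occVec f n`. -/
def occFact (n : ι →₀ ℕ) : ℝ := n.prod fun _ k => (k.factorial : ℝ)

theorem occFact_pos (n : ι →₀ ℕ) : 0 < occFact n :=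
  Finset.prod_pos fun _ _ => Nat.cast_pos.2 (Nat.factorial_pos _)

theorem occFact_add_single (n : ι →₀ ℕ) (i : ι) :
    occFact (n + Finsupp.single i 1) = (n i + 1) * occFact n := by
  classical
  have h : ∀ m : ι →₀ ℕ, m.support ⊆ insert i n.support →
      occFact m = (m i).factorial * ∏ j ∈ n.support.erase i, ((m j).factorial : ℝ) := by
    intro m hm
    rw [occFact, Finsupp.prod_of_support_subset m hm _ (fun _ _ => by simp),
      ← Finset.insert_erase (Finset.mem_insert_self i n.support),
      Finset.prod_insert (Finset.notMem_erase _ _), Finset.erase_insert_eq_erase]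
  rw [h n (Finset.subset_insert _ _), h (n + Finsupp.single i 1)]
  · rw [← mul_assoc]
    congr 1
    · rw [Finsupp.add_apply, Finsupp.single_eq_same, Nat.factorial_succ]
      push_cast
      ring
    · refine Finset.prod_congr rfl fun j hj => ?_
      rw [Finsupp.add_apply, Finsupp.single_eq_of_ne (Finset.ne_of_mem_erase hj), add_zero]
  · refine Finsupp.support_add.trans ?_
    intro j hj
    rcases Finset.mem_union.1 hj with hj | hj
    · exact Finset.mem_insert_of_mem hj
    · rw [Finset.mem_singleton.1 (Finsupp.support_single_subset hj)]
      exact Finset.mem_insert_self _ _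

theorem inner_occVec [DecidableEq ι] (n m : ι →₀ ℕ) :
    ⟪occVec f n, occVec f m⟫_ℂ = if n = m then (occFact n : ℂ) else 0 := by
  induction hd : n.degree generalizing n m with
  | zero =>
    rw [Finsupp.degree_eq_zero_iff] at hd
    subst hd
    split_ifs with h
    · subst h
      have h0 : occVec f 0 = symProd [] := by simp [occVec]
      rw [h0, inner_symProd]
      simp [occFact, symInner]
    · rw [occVec, occVec, inner_symProd, symInner_eq_zero]
      rw [length_toList_map, length_toList_map, map_zero]
      exact fun h0 => h ((Finsupp.degree_eq_zero_iff _).1 h0.symm).symm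
  | succ d ih =>
    obtain ⟨i, hi⟩ : ∃ i, n i ≠ 0 := by
      by_contra! h
      rw [show n = 0 from Finsupp.ext h, map_zero] at hd
      omega
    obtain ⟨n', rfl⟩ : ∃ n', n = n' + Finsupp.single i 1 :=
      ⟨n - Finsupp.single i 1, (tsub_add_cancel_of_le
        (Finsupp.single_le_iff.2 (Nat.one_le_iff_ne_zero.2 hi))).symm⟩
    rw [inner_occVec_add_single, ih n' _ (by simpa using hd)]
    by_cases hm : m i = 0
    · rw [hm, Nat.cast_zero, zero_mul, if_neg]
      rintro rfl
      exact hi hm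
    · obtain ⟨m', rfl⟩ : ∃ m', m = m' + Finsupp.single i 1 :=
        ⟨m - Finsupp.single i 1, (tsub_add_cancel_of_le
          (Finsupp.single_le_iff.2 (Nat.one_le_iff_ne_zero.2 hm))).symm⟩
      rw [add_tsub_cancel_right]
      by_cases h : n' = m'
      · subst h
        rw [if_pos rfl, if_pos rfl, occFact_add_single]
        simp
      · rw [if_neg h, if_neg fun h' => h (add_right_cancel h'), mul_zero]

theorem fockVec_eq (n : ι →₀ ℕ) :
    fockVec f n = ((√(occFact n) : ℝ) : ℂ)⁻¹ • occVec f n := rfl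

theorem occVec_eq (n : ι →₀ ℕ) :
    occVec f n = ((√(occFact n) : ℝ) : ℂ) • fockVec f n := by
  have : ((√(occFact n) : ℝ) : ℂ) ≠ 0 := by
    exact_mod_cast (Real.sqrt_pos.2 (occFact_pos n)).ne'
  rw [fockVec_eq, smul_smul, mul_inv_cancel₀ this, one_smul]

theorem orthonormal_fockVec : Orthonormal ℂ (fockVec f) := by
  classical
  rw [orthonormal_iff_ite]
  intro n m
  rw [fockVec_eq, fockVec_eq, inner_smul_left, inner_smul_right, inner_occVec]
  split_ifs with h
  · subst h
    have h0 : ((√(occFact n) : ℝ) : ℂ) ≠ 0 := by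
      exact_mod_cast (Real.sqrt_pos.2 (occFact_pos n)).ne'
    have h1 : (occFact n : ℂ) = ((√(occFact n) : ℝ) : ℂ) * ((√(occFact n) : ℝ) : ℂ) := by
      rw [← Complex.ofReal_mul, Real.mul_self_sqrt (occFact_pos n).le]
    rw [map_inv₀, Complex.conj_ofReal, h1]
    field_simp
  · simp

/-- Induction on the length: the closed span is stable under creation by basis vectors, and
continuity of v ↦ a*(v)x lets the head factor be expanded in `f`. -/
theorem symProd_mem_closure_span (l : List H) :
    symProd l ∈ (Submodule.span ℂ (Set.range (occVec f))).topologicalClosure := by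
  classical
  set S := (Submodule.span ℂ (Set.range (occVec f))).topologicalClosure with hS
  have hclosed : IsClosed (S : Set (Fock H)) := Submodule.isClosed_topologicalClosure _
  have hcreate : ∀ N i x, x ∈ S → create N (f i) x ∈ S := by
    intro N i x hx
    have h1 : Submodule.span ℂ (Set.range (occVec f)) ≤
        S.comap (create N (f i)).toLinearMap := by
      rw [Submodule.span_le]
      rintro _ ⟨n, rfl⟩
      change create N (f i) (occVec f n) ∈ S
      rw [create_occVec]
      split_ifs
      · exact Submodule.le_topologicalClosure _ (Submodule.subset_span ⟨_, rfl⟩)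
      · exact S.zero_mem
    exact Submodule.topologicalClosure_minimal _ h1
      (hclosed.preimage (create N (f i)).continuous) hx
  induction l with
  | nil =>
    refine Submodule.le_topologicalClosure _ (Submodule.subset_span ⟨0, ?_⟩)
    simp [occVec]
  | cons v l ih =>
    have h1 : symProd (v :: l) = (create l.length).flip (symProd l) v := by
      rw [ContinuousLinearMap.flip_apply, create_symProd, if_pos rfl]
    rw [h1]
    have h2 := (HilbertBasis.hasSum_inner_smul f v).mapL ((create l.length).flip (symProd l))
    refine hclosed.mem_of_tendsto h2 (Eventually.of_forall fun s => ?_)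
    refine S.sum_mem fun i _ => ?_
    rw [map_smul]
    exact S.smul_mem _ (hcreate _ _ _ ih)

/-- The Fock basis relative to an orthonormal basis of `H`. -/
def fockBasis : HilbertBasis (ι →₀ ℕ) ℂ (Fock H) :=
  HilbertBasis.mk (orthonormal_fockVec f) (by
    rw [← dense_span_symProd]
    refine Submodule.topologicalClosure_minimal _ ?_ (Submodule.isClosed_topologicalClosure _)
    rw [Submodule.span_le]
    rintro _ ⟨l, rfl⟩
    refine Submodule.topologicalClosure_mono ?_ (symProd_mem_closure_span f l)
    rw [Submodule.span_le]
    rintro _ ⟨n, rfl⟩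
    rw [occVec_eq]
    exact Submodule.smul_mem _ _ (Submodule.subset_span ⟨n, rfl⟩))

theorem fockBasis_apply (n : ι →₀ ℕ) : fockBasis f n = fockVec f n := by
  rw [fockBasis, HilbertBasis.coe_mk]

theorem create_fockVec (N : ℕ) (i : ι) (n : ι →₀ ℕ) :
    create N (f i) (fockVec f n) =
      if n.degree = N then ((√(n i + 1) : ℝ) : ℂ) • fockVec f (n + Finsupp.single i 1) else 0 := by
  rw [fockVec_eq, map_smul, create_occVec]
  split_ifs
  · rw [occVec_eq, smul_smul, occFact_add_single, Real.sqrt_mul (by positivity)]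
    congr 1
    have h0 : ((√(occFact n) : ℝ) : ℂ) ≠ 0 := by
      exact_mod_cast (Real.sqrt_pos.2 (occFact_pos n)).ne'
    push_cast
    field_simp
  · simp

theorem fockVec_mem_particleSpace (n : ι →₀ ℕ) : fockVec f n ∈ particleSpace H n.degree :=
  Submodule.smul_mem _ _ (Submodule.le_topologicalClosure _
    (Submodule.subset_span ⟨_, length_toList_map f n, rfl⟩))

theorem fockVec_mem_particleSpace_orthogonal {n : ι →₀ ℕ} {N : ℕ} (h : n.degree ≠ N) :
    fockVec f n ∈ (particleSpace H N)ᗮ := by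
  rw [particleSpace, Submodule.orthogonal_closure, Submodule.mem_orthogonal]
  intro x hx
  induction hx using Submodule.span_induction with
  | mem x hx =>
    obtain ⟨l, hl, rfl⟩ := hx
    rw [fockVec_eq, inner_smul_right, occVec, inner_symProd, symInner_eq_zero, mul_zero]
    rw [length_toList_map, hl]
    exact h.symm
  | zero => simp
  | add a b _ _ ha hb => rw [inner_add_left, ha, hb, add_zero]
  | smul c a _ ha => rw [inner_smul_left, ha, mul_zero]

end Basis

/-! ### Existence and uniqueness of the `1`-matrix -/

noncomputable section OneMatrix

theorem hasSum_of_tsum_ofReal {ι : Type*} {g : ι → ℝ} {s : ℝ} (hg : ∀ i, 0 ≤ g i) (hs : 0 ≤ s)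
    (h : ∑' i, ENNReal.ofReal (g i) = ENNReal.ofReal s) : HasSum g s := by
  have hsum : Summable g := by
    have := ENNReal.summable_toReal (f := fun i => ENNReal.ofReal (g i))
      (by rw [h]; exact ENNReal.ofReal_ne_top)
    simpa only [ENNReal.toReal_ofReal (hg _)] using this
  have h2 := ENNReal.ofReal_tsum_of_nonneg hg hsum
  rw [h] at h2
  rw [← (ENNReal.ofReal_eq_ofReal_iff (tsum_nonneg hg) hs).1 h2]
  exact hsum.hasSum

theorem tsum_ofReal_of_hasSum {ι : Type*} {g : ι → ℝ} {s : ℝ} (hg : ∀ i, 0 ≤ g i)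
    (h : HasSum g s) : ∑' i, ENNReal.ofReal (g i) = ENNReal.ofReal s := by
  rw [← h.tsum_eq, ENNReal.ofReal_tsum_of_nonneg hg h.summable]

variable {H : Type u} [NormedAddCommGroup H] [InnerProductSpace ℂ H]

theorem create_fockVec_of_ne {ι : Type u} (f : HilbertBasis ι ℂ H) {N : ℕ} (u : H) {n : ι →₀ ℕ}
    (h : n.degree ≠ N) : create N u (fockVec f n) = 0 := by
  rw [fockVec_eq, map_smul, occVec, create_symProd, if_neg, smul_zero]
  rwa [length_toList_map]

/-- The quadratic form `Tr(A a*(u) a(u))` of the `1`-matrix of a positive operator. -/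
def quadForm (A : Fock H →L[ℂ] Fock H) (u : H) : ℝ≥0∞ :=
  ∑' N : ℕ, posTrace ((create N u).adjoint ∘L A ∘L create N u)

variable {A : Fock H →L[ℂ] Fock H} {ι : Type u} (f : HilbertBasis ι ℂ H)

/-- A Fock vector is annihilated by all sector creation operators except that of its own degree, so
the sum over N collapses. -/
theorem quadForm_eq (hA : A.IsPositive) (u : H) :
    quadForm A u = ∑' n : ι →₀ ℕ, ENNReal.ofReal
      (⟪create n.degree u (fockVec f n), A (create n.degree u (fockVec f n))⟫_ℂ).re := by
  unfold quadForm
  simp_rw [posTrace_eq (hA.adjoint_conj _) (fockBasis f)]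
  rw [ENNReal.tsum_comm]
  refine tsum_congr fun n => ?_
  rw [tsum_eq_single n.degree]
  · simp only [ContinuousLinearMap.comp_apply, ContinuousLinearMap.adjoint_inner_right,
      fockBasis_apply]
  · intro N hN
    simp only [ContinuousLinearMap.comp_apply, ContinuousLinearMap.adjoint_inner_right,
      fockBasis_apply, create_fockVec_of_ne f u hN.symm]
    simp

/-- Occupation numbers shift by one under the addition of a particle. -/
theorem tsum_occupation_shift (g : (ι →₀ ℕ) → ℝ≥0∞) (i : ι) :
    ∑' n, (n i : ℝ≥0∞) * g n = ∑' n, (n i + 1 : ℝ≥0∞) * g (n + Finsupp.single i 1) := by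
  have hinj : Function.Injective fun n : ι →₀ ℕ => n + Finsupp.single i 1 :=
    add_left_injective _
  rw [← hinj.tsum_eq]
  · refine tsum_congr fun n => ?_
    rw [Finsupp.add_apply, Finsupp.single_eq_same, Nat.cast_add, Nat.cast_one]
  · intro m hm
    have hm' : m i ≠ 0 := fun h => hm (by simp [h])
    exact ⟨m - Finsupp.single i 1, tsub_add_cancel_of_le
      (Finsupp.single_le_iff.2 (Nat.one_le_iff_ne_zero.2 hm'))⟩

/-- From a*(f i)|n⟩ = √(n i + 1)|n + e_i⟩ and the shift of occupation numbers. The left side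
involves the whole basis, the right side only the vector `f i`; this makes a basis-free `1`-matrix
possible. -/
theorem tsum_occupation (hA : A.IsPositive) (i : ι) :
    ∑' n : ι →₀ ℕ, (n i : ℝ≥0∞) * ENNReal.ofReal (⟪fockVec f n, A (fockVec f n)⟫_ℂ).re =
      quadForm A (f i) := by
  rw [quadForm_eq f hA, tsum_occupation_shift]
  refine tsum_congr fun n => ?_
  rw [create_fockVec, if_pos rfl, map_smul, inner_smul_left, inner_smul_right,
    Complex.conj_ofReal, ← mul_assoc, ← Complex.ofReal_mul, Real.mul_self_sqrt (by positivity),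
    Complex.re_ofReal_mul, ENNReal.ofReal_mul (by positivity)]
  congr 1
  exact_mod_cast (ENNReal.ofReal_natCast (n i + 1)).symm

theorem meanNumber_eq (Δ : DensityOperator (Fock H)) :
    meanNumber Δ = ∑' i, quadForm Δ.op (f i) := by
  classical
  simp_rw [← tsum_occupation f Δ.isPositive]
  rw [ENNReal.tsum_comm]
  have h1 : ∀ N : ℕ, posTrace (particleProj H N ∘L Δ.op ∘L particleProj H N) =
      ∑' n : ι →₀ ℕ, if n.degree = N then
        ENNReal.ofReal (⟪fockBasis f n, Δ.op (fockBasis f n)⟫_ℂ).re else 0 := fun N =>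
    posTrace_conj_starProjection (fockBasis f) _ _
      (fun n hn => by rw [fockBasis_apply, ← hn]; exact fockVec_mem_particleSpace f n)
      (fun n hn => by rw [fockBasis_apply]; exact fockVec_mem_particleSpace_orthogonal f hn)
      Δ.isPositive
  unfold meanNumber
  simp_rw [h1, ← ENNReal.tsum_mul_left]
  rw [ENNReal.tsum_comm]
  refine tsum_congr fun n => ?_
  rw [tsum_eq_single n.degree fun N hN => by rw [if_neg hN.symm, mul_zero], if_pos rfl,
    ENNReal.tsum_mul_right, fockBasis_apply]
  congr 1
  rw [tsum_eq_sum (s := n.support) fun i hi => by simpa using hi, ← Nat.cast_sum]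
  rfl

variable [CompleteSpace H]

/-- A positive operator with finite mean particle number has a positive `1`-matrix. -/
theorem exists_oneMatrix (hA : A.IsPositive) (hfin : ∑' i, quadForm A (f i) ≠ ⊤) :
    ∃ γ : H →L[ℂ] H, γ.IsPositive ∧ ∀ u, ENNReal.ofReal (⟪u, γ u⟫_ℂ).re = quadForm A u := by
  -- T n is u ↦ a*(u)|n⟩, and G n is the contribution of |n⟩ to γ; thus γ = ∑ T_n* A T_n.
  let T : (ι →₀ ℕ) → H →L[ℂ] Fock H := fun n => (create n.degree).flip (fockVec f n)
  let G : (ι →₀ ℕ) → H →L[ℂ] H := fun n => (T n).adjoint ∘L A ∘L T n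
  have hG : ∀ n, (G n).IsPositive := fun n => hA.adjoint_conj _
  have hGu : ∀ n u, ⟪u, G n u⟫_ℂ =
      ⟪create n.degree u (fockVec f n), A (create n.degree u (fockVec f n))⟫_ℂ := fun n u => by
    simp only [G, T, ContinuousLinearMap.comp_apply, ContinuousLinearMap.adjoint_inner_right,
      ContinuousLinearMap.flip_apply]
  -- Norms are bounded by traces, and the traces of the G n add up to the mean particle number.
  have hsum : Summable G := by
    refine Summable.of_enorm (ne_top_of_le_ne_top hfin ?_)
    simp_rw [quadForm_eq f hA]
    rw [ENNReal.tsum_comm]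
    refine ENNReal.tsum_le_tsum fun n => (enorm_le_posTrace (hG n)).trans_eq ?_
    rw [posTrace_eq (hG n) f]
    exact tsum_congr fun i => by rw [hGu]
  have hγ : ∀ u, HasSum (fun n => ⟪u, G n u⟫_ℂ) ⟪u, (∑' n, G n) u⟫_ℂ := fun u =>
    (hsum.hasSum.mapL (ContinuousLinearMap.apply ℂ H u)).mapL (innerSL ℂ u)
  have hre : ∀ u, HasSum (fun n => (⟪u, G n u⟫_ℂ).re) (⟪u, (∑' n, G n) u⟫_ℂ).re := fun u =>
    Complex.hasSum_re (hγ u)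
  have hnn : ∀ u n, 0 ≤ (⟪u, G n u⟫_ℂ).re := fun u n => (hG n).re_inner_nonneg_right u
  refine ⟨∑' n, G n, ?_, fun u => ?_⟩
  · rw [← ContinuousLinearMap.nonneg_iff_isPositive]
    exact tsum_nonneg fun n => (ContinuousLinearMap.nonneg_iff_isPositive _).2 (hG n)
  · rw [quadForm_eq f hA, ← tsum_ofReal_of_hasSum (hnn u) (hre u)]
    exact tsum_congr fun n => by rw [hGu]

theorem isOneMatrix_of_quadForm (Δ : DensityOperator (Fock H)) {γ : H →L[ℂ] H}
    (hγ : γ.IsPositive) (h : ∀ u, ‖u‖ = 1 → ENNReal.ofReal (⟪u, γ u⟫_ℂ).re = quadForm Δ.op u) :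
    IsOneMatrix Δ γ := by
  refine ⟨hγ.isSelfAdjoint, fun κ g i => ?_⟩
  have hnn : ∀ n : κ →₀ ℕ, 0 ≤ (⟪fockVec g n, Δ.op (fockVec g n)⟫_ℂ).re := fun n =>
    Δ.isPositive.re_inner_nonneg_right _
  refine hasSum_of_tsum_ofReal (fun n => mul_nonneg (Nat.cast_nonneg _) (hnn n))
    (hγ.re_inner_nonneg_right _) ?_
  rw [h _ (g.orthonormal.1 i), ← tsum_occupation g Δ.isPositive]
  refine tsum_congr fun n => ?_
  rw [ENNReal.ofReal_mul (Nat.cast_nonneg _), ENNReal.ofReal_natCast]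

/-- Nonnegativity is recorded as well, since `IsOneMatrix` only demands a Hermitian γ and
`ENNReal.ofReal` would hide a negative value. -/
theorem IsOneMatrix.quadForm_basis {Δ : DensityOperator (Fock H)} {γ : H →L[ℂ] H}
    (h : IsOneMatrix Δ γ) (i : ι) :
    0 ≤ (⟪f i, γ (f i)⟫_ℂ).re ∧ ENNReal.ofReal (⟪f i, γ (f i)⟫_ℂ).re = quadForm Δ.op (f i) := by
  have hnn : ∀ n : ι →₀ ℕ, 0 ≤ (⟪fockVec f n, Δ.op (fockVec f n)⟫_ℂ).re := fun n =>
    Δ.isPositive.re_inner_nonneg_right _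
  have h1 := h.2 ι f i
  refine ⟨h1.nonneg fun n => mul_nonneg (Nat.cast_nonneg _) (hnn n), ?_⟩
  rw [← tsum_ofReal_of_hasSum (fun n => mul_nonneg (Nat.cast_nonneg _) (hnn n)) h1,
    ← tsum_occupation f Δ.isPositive]
  refine tsum_congr fun n => ?_
  rw [ENNReal.ofReal_mul (Nat.cast_nonneg _), ENNReal.ofReal_natCast]

theorem IsOneMatrix.quadForm_eq {Δ : DensityOperator (Fock H)} {γ : H →L[ℂ] H}
    (h : IsOneMatrix Δ γ) {u : H} (hu : ‖u‖ = 1) :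
    0 ≤ (⟪u, γ u⟫_ℂ).re ∧ ENNReal.ofReal (⟪u, γ u⟫_ℂ).re = quadForm Δ.op u := by
  obtain ⟨w, b, i, rfl⟩ := exists_hilbertBasis_mem hu
  exact h.quadForm_basis b i

theorem IsOneMatrix.unique {Δ : DensityOperator (Fock H)} {γ γ' : H →L[ℂ] H}
    (h : IsOneMatrix Δ γ) (h' : IsOneMatrix Δ γ') : γ = γ' := by
  refine eq_of_re_inner_eq h.1 h'.1 fun u hu => ?_
  have h1 := h.quadForm_eq hu
  have h2 := h'.quadForm_eq hu
  exact (ENNReal.ofReal_eq_ofReal_iff h1.1 h2.1).1 (h1.2.trans h2.2.symm)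

end OneMatrix

/-! ### The extended logarithm -/

section NegLog

theorem negLog_one : negLog 1 = 0 := by simp [negLog]

theorem negLog_mul {a b : ℝ} (ha : 0 ≤ a) (ha1 : a ≤ 1) (hb : 0 ≤ b) (hb1 : b ≤ 1) :
    negLog (a * b) = negLog a + negLog b := by
  rcases ha.eq_or_lt with rfl | ha
  · simp [negLog]
  rcases hb.eq_or_lt with rfl | hb
  · simp [negLog]
  rw [negLog, negLog, negLog, if_neg (mul_pos ha hb).not_ge, if_neg ha.not_ge, if_neg hb.not_ge,
    Real.log_mul ha.ne' hb.ne', neg_add, ENNReal.ofReal_add]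
  · exact neg_nonneg.2 (Real.log_nonpos ha.le ha1)
  · exact neg_nonneg.2 (Real.log_nonpos hb.le hb1)

theorem negLog_pow {a : ℝ} (ha : 0 ≤ a) (ha1 : a ≤ 1) (k : ℕ) :
    negLog (a ^ k) = k * negLog a := by
  induction k with
  | zero => simp [negLog_one]
  | succ k ih =>
    rw [pow_succ, negLog_mul (pow_nonneg ha k) (pow_le_one₀ ha ha1) ha ha1, ih]
    push_cast
    ring

theorem negLog_prod {ι : Type*} (s : Finset ι) {a : ι → ℝ} (ha : ∀ i, 0 ≤ a i)
    (ha1 : ∀ i, a i ≤ 1) : negLog (∏ i ∈ s, a i) = ∑ i ∈ s, negLog (a i) := by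
  induction s using Finset.cons_induction with
  | empty => simp [negLog_one]
  | cons i s hi ih =>
    rw [Finset.prod_cons, Finset.sum_cons, negLog_mul (ha i) (ha1 i)
      (Finset.prod_nonneg fun i _ => ha i) (Finset.prod_le_one (fun i _ => ha i) fun i _ => ha1 i),
      ih]

end NegLog

/-! ### Eigenvalues of free states -/

noncomputable section Weight

variable {ι : Type*} {z : ι → ℝ}

/-- The parameters of a free state. -/
structure IsParam (z : ι → ℝ) : Prop where
  nonneg : ∀ i, 0 ≤ z i
  lt_one : ∀ i, z i < 1
  summable : Summable z

/-- The eigenvalue of a free state for the occupation list `n`. -/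
def weight (z : ι → ℝ) (n : ι →₀ ℕ) : ℝ := ∏' i, ((1 - z i) * z i ^ n i)

/-- The vacuum eigenvalue of a free state. -/
def vacWeight (z : ι → ℝ) : ℝ := ∏' i, (1 - z i)

/-- The product of the powers `z i ^ n i`. -/
def monomial (z : ι → ℝ) (n : ι →₀ ℕ) : ℝ := n.prod fun i k => z i ^ k

theorem IsParam.summable_log (h : IsParam z) : Summable fun i => Real.log (1 - z i) := by
  simpa only [sub_eq_add_neg] using Real.summable_log_one_add_of_summable h.summable.neg

theorem IsParam.hasProd (h : IsParam z) :
    HasProd (fun i => 1 - z i) (Real.exp (∑' i, Real.log (1 - z i))) :=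
  Real.hasProd_of_hasSum_log (fun i => sub_pos.2 (h.lt_one i)) h.summable_log.hasSum

theorem IsParam.vacWeight_eq (h : IsParam z) :
    vacWeight z = Real.exp (∑' i, Real.log (1 - z i)) :=
  h.hasProd.tprod_eq

theorem IsParam.vacWeight_pos (h : IsParam z) : 0 < vacWeight z := by
  rw [h.vacWeight_eq]
  exact Real.exp_pos _

theorem IsParam.monomial_nonneg (h : IsParam z) (n : ι →₀ ℕ) : 0 ≤ monomial z n :=
  Finset.prod_nonneg fun i _ => pow_nonneg (h.nonneg i) _

theorem IsParam.monomial_le_one (h : IsParam z) (n : ι →₀ ℕ) : monomial z n ≤ 1 :=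
  Finset.prod_le_one (fun i _ => pow_nonneg (h.nonneg i) _)
    fun i _ => pow_le_one₀ (h.nonneg i) (h.lt_one i).le

theorem monomial_add_single (n : ι →₀ ℕ) (i : ι) :
    monomial z (n + Finsupp.single i 1) = z i * monomial z n := by
  classical
  rw [monomial, Finsupp.prod_add_index' (fun _ => pow_zero _) (fun _ _ _ => pow_add _ _ _),
    Finsupp.prod_single_index (h := fun i k => z i ^ k) (pow_zero _), pow_one, mul_comm, monomial]

theorem IsParam.weight_eq (h : IsParam z) (n : ι →₀ ℕ) :
    weight z n = vacWeight z * monomial z n := by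
  have h2 : HasProd (fun i => z i ^ n i) (monomial z n) :=
    hasProd_prod_of_ne_finset_one fun i hi => by
      rw [Finsupp.notMem_support_iff.1 hi, pow_zero]
  exact ((h.hasProd.mul h2).tprod_eq).trans (by rw [h.vacWeight_eq])

theorem IsParam.vacWeight_le_prod (h : IsParam z) (s : Finset ι) :
    vacWeight z ≤ ∏ i ∈ s, (1 - z i) := by
  classical
  have hp := h.hasProd
  rw [← h.vacWeight_eq] at hp
  refine le_of_tendsto hp ?_
  filter_upwards [eventually_ge_atTop s] with t ht
  rw [← Finset.prod_sdiff ht]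
  refine mul_le_of_le_one_left (Finset.prod_nonneg fun i _ => (sub_pos.2 (h.lt_one i)).le) ?_
  exact Finset.prod_le_one (fun i _ => (sub_pos.2 (h.lt_one i)).le)
    fun i _ => sub_le_self _ (h.nonneg i)

theorem IsParam.vacWeight_le_one (h : IsParam z) : vacWeight z ≤ 1 := by
  simpa using h.vacWeight_le_prod ∅

theorem IsParam.weight_nonneg (h : IsParam z) (n : ι →₀ ℕ) : 0 ≤ weight z n := by
  rw [h.weight_eq]
  exact mul_nonneg h.vacWeight_pos.le (h.monomial_nonneg n)

theorem IsParam.weight_add_single (h : IsParam z) (n : ι →₀ ℕ) (i : ι) :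
    weight z (n + Finsupp.single i 1) = z i * weight z n := by
  rw [h.weight_eq, h.weight_eq, monomial_add_single]
  ring

theorem IsParam.negLog_vacWeight (h : IsParam z) :
    negLog (vacWeight z) = ∑' i, ENNReal.ofReal (-Real.log (1 - z i)) := by
  rw [negLog, if_neg h.vacWeight_pos.not_ge, h.vacWeight_eq, Real.log_exp, ← tsum_neg,
    ENNReal.ofReal_tsum_of_nonneg (fun i => ?_) h.summable_log.neg]
  exact neg_nonneg.2 (Real.log_nonpos (sub_pos.2 (h.lt_one i)).le (sub_le_self _ (h.nonneg i)))

theorem IsParam.negLog_weight (h : IsParam z) (n : ι →₀ ℕ) :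
    negLog (weight z n) =
      ∑' i, ENNReal.ofReal (-Real.log (1 - z i)) + ∑' i, (n i : ℝ≥0∞) * negLog (z i) := by
  rw [h.weight_eq, negLog_mul h.vacWeight_pos.le h.vacWeight_le_one (h.monomial_nonneg n)
    (h.monomial_le_one n), h.negLog_vacWeight, monomial, Finsupp.prod,
    negLog_prod _ (fun i => pow_nonneg (h.nonneg i) _)
      fun i => pow_le_one₀ (h.nonneg i) (h.lt_one i).le]
  congr 1
  rw [tsum_eq_sum (s := n.support) fun i hi => by rw [Finsupp.notMem_support_iff.1 hi]; simp]
  exact Finset.sum_congr rfl fun i _ => negLog_pow (h.nonneg i) (h.lt_one i).le _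

/-- Summation over the occupation number of one mode. -/
theorem tsum_fiber {g : (ι →₀ ℕ) → ℝ≥0∞} {i : ι} {ζ : ℝ≥0∞}
    (hg : ∀ n, g (n + Finsupp.single i 1) = ζ * g n) (φ : ℕ → ℝ≥0∞) :
    ∑' n, φ (n i) * g n = (∑' k, φ k * ζ ^ k) * ∑' n, if n i = 0 then g n else 0 := by
  have hinj : Function.Injective fun n : ι →₀ ℕ => n + Finsupp.single i 1 :=
    add_left_injective _
  have hF : ∀ k, ∑' n, (if n i = k then g n else 0) = ζ ^ k * ∑' n, if n i = 0 then g n else 0 := by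
    intro k
    induction k with
    | zero => simp
    | succ k ih =>
      rw [← hinj.tsum_eq]
      · rw [pow_succ', mul_assoc, ← ih, ← ENNReal.tsum_mul_left]
        refine tsum_congr fun n => ?_
        simp [hg]
      · intro m hm
        have hm' : m i ≠ 0 := fun h => hm (by simp [h])
        exact ⟨m - Finsupp.single i 1, tsub_add_cancel_of_le
          (Finsupp.single_le_iff.2 (Nat.one_le_iff_ne_zero.2 hm'))⟩
  have h1 : ∀ n, φ (n i) * g n = ∑' k, φ k * if n i = k then g n else 0 := fun n => by
    rw [tsum_eq_single (n i) fun k hk => by rw [if_neg hk.symm, mul_zero], if_pos rfl]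
  simp_rw [h1]
  rw [ENNReal.tsum_comm, ← ENNReal.tsum_mul_right]
  refine tsum_congr fun k => ?_
  rw [ENNReal.tsum_mul_left, hF, mul_assoc]

/-- The partition function of finitely many modes is a product of geometric series; `tsum_fiber`
splits off one mode at a time. -/
theorem IsParam.tsum_monomial_subset [DecidableEq ι] (h : IsParam z) (s : Finset ι) :
    ∑' n : ι →₀ ℕ, (if n.support ⊆ s then ENNReal.ofReal (monomial z n) else 0) =
      ENNReal.ofReal (∏ i ∈ s, (1 - z i))⁻¹ := by
  induction s using Finset.induction_on with
  | empty =>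
    rw [tsum_eq_single 0]
    · simp [monomial]
    · intro n hn
      rw [if_neg]
      simpa using hn
  | insert i s hi ih =>
    have h1 := tsum_fiber (i := i) (ζ := ENNReal.ofReal (z i)) (φ := fun _ => 1)
      (g := fun n : ι →₀ ℕ => if n.support ⊆ insert i s then ENNReal.ofReal (monomial z n) else 0)
      (fun n => by
        have : (n + Finsupp.single i 1).support ⊆ insert i s ↔ n.support ⊆ insert i s := by
          simp only [Finset.subset_iff, Finsupp.mem_support_iff, Finset.mem_insert]
          refine forall_congr' fun j => ?_
          by_cases hj : j = i
          · simp [hj]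
          · simp [hj]
        simp only [this, monomial_add_single, ENNReal.ofReal_mul (h.nonneg i), mul_ite, mul_zero])
    simp only [one_mul] at h1
    rw [h1, ENNReal.tsum_geometric, Finset.prod_insert hi, mul_inv, ENNReal.ofReal_mul
      (inv_nonneg.2 (sub_pos.2 (h.lt_one i)).le), ← ih,
      ENNReal.ofReal_inv_of_pos (sub_pos.2 (h.lt_one i)),
      ENNReal.ofReal_sub _ (h.nonneg i), ENNReal.ofReal_one]
    congr 1
    refine tsum_congr fun n => ?_
    have : (n i = 0 ∧ n.support ⊆ insert i s) ↔ n.support ⊆ s := by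
      rw [← Finsupp.notMem_support_iff]
      constructor
      · rintro ⟨h1, h2⟩
        exact (Finset.subset_insert_iff_of_notMem h1).1 h2
      · exact fun h1 => ⟨fun h2 => hi (h1 h2), h1.trans (Finset.subset_insert _ _)⟩
    rw [← ite_and]
    simp only [this]

/-- The monomials sum to 1/`vacWeight`: any finite set of occupation lists involves finitely many
modes, which bounds the sum above, and exhausting the modes by finite sets bounds it below. -/
theorem IsParam.tsum_weight (h : IsParam z) : ∑' n, ENNReal.ofReal (weight z n) = 1 := by
  classical
  have hS : ∑' n, ENNReal.ofReal (weight z n) =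
      ENNReal.ofReal (vacWeight z) * ∑' n, ENNReal.ofReal (monomial z n) := by
    rw [← ENNReal.tsum_mul_left]
    exact tsum_congr fun n => by rw [h.weight_eq, ENNReal.ofReal_mul h.vacWeight_pos.le]
  have hle : ∑' n, ENNReal.ofReal (monomial z n) ≤ ENNReal.ofReal (vacWeight z)⁻¹ := by
    rw [ENNReal.tsum_eq_iSup_sum]
    refine iSup_le fun T => ?_
    have h1 : ∑ n ∈ T, ENNReal.ofReal (monomial z n) ≤
        ∑' n : ι →₀ ℕ, (if n.support ⊆ T.biUnion Finsupp.support then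
          ENNReal.ofReal (monomial z n) else 0) := by
      refine le_trans (Finset.sum_le_sum fun n hn => ?_) (ENNReal.sum_le_tsum T)
      rw [if_pos (Finset.subset_biUnion_of_mem _ hn)]
    rw [h.tsum_monomial_subset] at h1
    refine h1.trans (ENNReal.ofReal_le_ofReal ?_)
    exact inv_anti₀ h.vacWeight_pos (h.vacWeight_le_prod _)
  have hge : ENNReal.ofReal (vacWeight z)⁻¹ ≤ ∑' n, ENNReal.ofReal (monomial z n) := by
    have hp := h.hasProd
    rw [← h.vacWeight_eq] at hp
    have hp' := ENNReal.tendsto_ofReal (hp.inv₀ h.vacWeight_pos.ne')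
    refine le_of_tendsto hp' (Eventually.of_forall fun s => ?_)
    rw [Finset.prod_inv_distrib, ← h.tsum_monomial_subset]
    refine ENNReal.tsum_le_tsum fun n => ?_
    split_ifs
    · exact le_rfl
    · exact zero_le
  rw [hS, le_antisymm hle hge, ← ENNReal.ofReal_mul h.vacWeight_pos.le,
    mul_inv_cancel₀ h.vacWeight_pos.ne', ENNReal.ofReal_one]

theorem IsParam.summable_weight (h : IsParam z) : Summable (weight z) := by
  have := ENNReal.summable_toReal (f := fun n => ENNReal.ofReal (weight z n))
    (by rw [h.tsum_weight]; exact ENNReal.one_ne_top)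
  simpa only [ENNReal.toReal_ofReal (h.weight_nonneg _)] using this

/-- The mean occupation number of a mode in a free state. -/
theorem IsParam.tsum_occupation_weight (h : IsParam z) (i : ι) :
    ∑' n : ι →₀ ℕ, (n i : ℝ≥0∞) * ENNReal.ofReal (weight z n) =
      ENNReal.ofReal (z i / (1 - z i)) := by
  have h0 : 0 < 1 - z i := sub_pos.2 (h.lt_one i)
  have hg : ∀ n : ι →₀ ℕ, ENNReal.ofReal (weight z (n + Finsupp.single i 1)) =
      ENNReal.ofReal (z i) * ENNReal.ofReal (weight z n) := fun n => by
    rw [h.weight_add_single, ENNReal.ofReal_mul (h.nonneg i)]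
  have h1 := tsum_fiber (g := fun n => ENNReal.ofReal (weight z n)) hg (fun _ => 1)
  have h2 := tsum_fiber (g := fun n => ENNReal.ofReal (weight z n)) hg (fun k => (k : ℝ≥0∞))
  simp only [one_mul] at h1
  rw [h.tsum_weight, ENNReal.tsum_geometric] at h1
  have h3 : ∑' k : ℕ, (k : ℝ≥0∞) * ENNReal.ofReal (z i) ^ k =
      ENNReal.ofReal (z i / (1 - z i) ^ 2) := by
    rw [← tsum_ofReal_of_hasSum (fun k => mul_nonneg (Nat.cast_nonneg k) (pow_nonneg (h.nonneg i) k))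
      (hasSum_coe_mul_geometric_of_norm_lt_one (r := z i)
        (by rw [Real.norm_of_nonneg (h.nonneg i)]; exact h.lt_one i))]
    exact tsum_congr fun k => by
      rw [ENNReal.ofReal_mul (Nat.cast_nonneg k), ENNReal.ofReal_natCast,
        ENNReal.ofReal_pow (h.nonneg i)]
  rw [h2, h3]
  -- The probability that the mode is empty, read off from normalization and the geometric series;
  -- times ∑ k zᵏ = z/(1-z)² it gives the mean z/(1-z).
  have h4 : ∑' n : ι →₀ ℕ, (if n i = 0 then ENNReal.ofReal (weight z n) else 0) =
      ENNReal.ofReal (1 - z i) := by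
    rw [ENNReal.ofReal_sub _ (h.nonneg i), ENNReal.ofReal_one]
    have h5 : (1 : ℝ≥0∞) - ENNReal.ofReal (z i) ≠ 0 := by
      rw [← ENNReal.ofReal_one, ← ENNReal.ofReal_sub _ (h.nonneg i)]
      simpa using h.lt_one i
    have h6 : (1 : ℝ≥0∞) - ENNReal.ofReal (z i) ≠ ⊤ := by finiteness
    calc _ = (1 - ENNReal.ofReal (z i)) * ((1 - ENNReal.ofReal (z i))⁻¹ * _) := by
          rw [← mul_assoc, ENNReal.mul_inv_cancel h5 h6, one_mul]
      _ = _ := by rw [← h1, mul_one]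
  rw [h4, ← ENNReal.ofReal_mul (div_nonneg (h.nonneg i) (sq_nonneg _))]
  congr 1
  field_simp

end Weight

/-! ### Free states and their one-particle operators -/

noncomputable section Free

variable {H : Type u} [NormedAddCommGroup H] [InnerProductSpace ℂ H]

/-- `Γ` is the free state with parameters `z` relative to the orthonormal basis `f`. -/
structure IsFreeWith {ι : Type u} (Γ : DensityOperator (Fock H)) (f : HilbertBasis ι ℂ H)
    (z : ι → ℝ) : Prop where
  param : IsParam z
  apply_fockVec : ∀ n, Γ.op (fockVec f n) = (weight z n : ℂ) • fockVec f n

theorem IsFreeWith.apply_fockBasis {ι : Type u} {Γ : DensityOperator (Fock H)}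
    {f : HilbertBasis ι ℂ H} {z : ι → ℝ} (h : IsFreeWith Γ f z) (n : ι →₀ ℕ) :
    Γ.op (fockBasis f n) = (weight z n : ℂ) • fockBasis f n := by
  rw [fockBasis_apply, h.apply_fockVec]

theorem isFree_iff {Γ : DensityOperator (Fock H)} :
    IsFree Γ ↔ ∃ (ι : Type u) (f : HilbertBasis ι ℂ H) (z : ι → ℝ), IsFreeWith Γ f z := by
  constructor
  · rintro ⟨ι, f, z, hz, hs, h⟩
    exact ⟨ι, f, z, ⟨fun i => (hz i).1, fun i => (hz i).2, hs⟩, fun n =>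
      Orthonormal.apply_of_hasSum (orthonormal_fockVec f) h n⟩
  · rintro ⟨ι, f, z, h⟩
    refine ⟨ι, f, z, fun i => ⟨h.param.nonneg i, h.param.lt_one i⟩, h.param.summable, fun ψ => ?_⟩
    simpa only [fockBasis_apply, weight] using
      HilbertBasis.hasSum_diagonal (fockBasis f) h.apply_fockBasis ψ

theorem exists_isFreeWith {ι : Type u} (f : HilbertBasis ι ℂ H) {z : ι → ℝ} (h : IsParam z) :
    ∃ Γ, IsFreeWith Γ f z := by
  obtain ⟨A, hA, hn⟩ := exists_diagonal (fockBasis f) h.weight_nonneg h.summable_weight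
  refine ⟨⟨A, hA, ?_⟩, h, fun n => ?_⟩
  · rw [posTrace_diagonal (fockBasis f) hA hn, h.tsum_weight]
  · simpa only [fockBasis_apply] using hn n

variable {ι : Type u} {Γ : DensityOperator (Fock H)} {f : HilbertBasis ι ℂ H} {z : ι → ℝ}

/-- At most one i satisfies m = n + e_i, so squaring the expansion in u produces no cross terms. -/
theorem inner_create_fockVec [DecidableEq ι] (u : H) (n m : ι →₀ ℕ) :
    ‖⟪fockVec f m, create n.degree u (fockVec f n)⟫_ℂ‖ₑ ^ 2 =
      ∑' i, ‖⟪f i, u⟫_ℂ‖ₑ ^ 2 * if m = n + Finsupp.single i 1 then (n i + 1 : ℝ≥0∞) else 0 := by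
  have hs := ((HilbertBasis.hasSum_inner_smul f u).mapL
    ((create n.degree).flip (fockVec f n))).mapL (innerSL ℂ (fockVec f m))
  have hterm : ∀ i, innerSL ℂ (fockVec f m) ((create n.degree).flip (fockVec f n)
      (⟪f i, u⟫_ℂ • f i)) = if m = n + Finsupp.single i 1 then
        ⟪f i, u⟫_ℂ * ((√(n i + 1) : ℝ) : ℂ) else 0 := by
    intro i
    rw [map_smul, ContinuousLinearMap.flip_apply, create_fockVec, if_pos rfl, map_smul, map_smul,
      innerSL_apply_apply, orthonormal_iff_ite.1 (orthonormal_fockVec f)]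
    split_ifs <;> simp
  simp only [hterm] at hs
  rw [ContinuousLinearMap.flip_apply, innerSL_apply_apply] at hs
  by_cases hm : ∃ i, m = n + Finsupp.single i 1
  · obtain ⟨i, rfl⟩ := hm
    have hne : ∀ j, j ≠ i → ¬ (n + Finsupp.single i 1 = n + Finsupp.single j 1) := by
      intro j hj h
      exact hj (Finsupp.single_left_injective one_ne_zero (add_left_cancel h)).symm
    rw [← hs.tsum_eq, tsum_eq_single i fun j hj => if_neg (hne j hj), if_pos rfl,
      tsum_eq_single i fun j hj => by rw [if_neg (hne j hj), mul_zero], if_pos rfl, enorm_mul,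
      mul_pow]
    congr 1
    rw [← ofReal_norm, ← ENNReal.ofReal_pow (norm_nonneg _), Complex.norm_real,
      Real.norm_of_nonneg (Real.sqrt_nonneg _), Real.sq_sqrt (by positivity)]
    exact_mod_cast ENNReal.ofReal_natCast (n i + 1)
  · push Not at hm
    rw [← hs.tsum_eq]
    simp [hm]

/-- The `1`-matrix of a free state is diagonal in `f` with eigenvalues z_i/(1-z_i). -/
theorem IsFreeWith.quadForm_eq (h : IsFreeWith Γ f z) (u : H) :
    quadForm Γ.op u = ∑' i, ENNReal.ofReal (z i / (1 - z i)) * ‖⟪f i, u⟫_ℂ‖ₑ ^ 2 := by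
  classical
  rw [BosonFock.quadForm_eq f Γ.isPositive]
  simp_rw [ofReal_re_inner_diagonal (fockBasis f) h.param.weight_nonneg h.apply_fockBasis,
    fockBasis_apply, inner_create_fockVec, ← ENNReal.tsum_mul_left]
  have h1 : ∀ n : ι →₀ ℕ, ∑' (m : ι →₀ ℕ) (i : ι), ENNReal.ofReal (weight z m) *
      (‖⟪f i, u⟫_ℂ‖ₑ ^ 2 * if m = n + Finsupp.single i 1 then (n i + 1 : ℝ≥0∞) else 0) =
      ∑' i, ((n i + 1 : ℝ≥0∞) * ENNReal.ofReal (weight z (n + Finsupp.single i 1))) *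
        ‖⟪f i, u⟫_ℂ‖ₑ ^ 2 := by
    intro n
    rw [ENNReal.tsum_comm]
    refine tsum_congr fun i => ?_
    rw [tsum_eq_single (n + Finsupp.single i 1) fun m hm => by rw [if_neg hm, mul_zero, mul_zero],
      if_pos rfl]
    ring
  simp_rw [h1]
  rw [ENNReal.tsum_comm]
  refine tsum_congr fun i => ?_
  rw [ENNReal.tsum_mul_right, ← tsum_occupation_shift (fun n => ENNReal.ofReal (weight z n)) i,
    h.param.tsum_occupation_weight]

theorem tsum_inner_fockVec (Δ : DensityOperator (Fock H)) (f : HilbertBasis ι ℂ H) :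
    ∑' n, ENNReal.ofReal (⟪fockVec f n, Δ.op (fockVec f n)⟫_ℂ).re = 1 := by
  rw [← Δ.trace_eq_one, posTrace_eq Δ.isPositive (fockBasis f)]
  simp_rw [fockBasis_apply]

/-- `-Tr(Δ log Γ)` for a free state `Γ`, in terms of the `1`-matrix of `Δ`. -/
theorem IsFreeWith.neg_traceLog (h : IsFreeWith Γ f z) (Δ : DensityOperator (Fock H)) :
    -traceLog Δ Γ = ((∑' i, (ENNReal.ofReal (-Real.log (1 - z i)) +
      negLog (z i) * quadForm Δ.op (f i)) : ℝ≥0∞) : EReal) := by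
  rw [traceLog, neg_neg, tsum_negLog_mul_posTrace (fockBasis f) Δ.isPositive h.apply_fockBasis]
  congr 1
  simp_rw [fockBasis_apply, h.param.negLog_weight, add_mul]
  rw [ENNReal.tsum_add, ENNReal.tsum_mul_left, tsum_inner_fockVec, mul_one, ENNReal.tsum_add]
  congr 1
  simp_rw [← ENNReal.tsum_mul_right]
  rw [ENNReal.tsum_comm]
  refine tsum_congr fun i => ?_
  rw [← tsum_occupation f Δ.isPositive, ← ENNReal.tsum_mul_left]
  refine tsum_congr fun n => ?_
  ring

theorem IsFreeWith.apply_symProd_nil (h : IsFreeWith Γ f z) :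
    Γ.op (symProd []) = (vacWeight z : ℂ) • symProd [] := by
  have h0 : symProd [] = fockVec f 0 := by simp [fockVec]
  rw [h0, h.apply_fockVec]
  simp [weight, vacWeight]

/-- A free state intertwines creation operators. -/
theorem IsFreeWith.apply_create (h : IsFreeWith Γ f z) {K : H →L[ℂ] H}
    (hK : ∀ i, K (f i) = (z i : ℂ) • f i) (N : ℕ) (v : H) (x : Fock H) :
    Γ.op (create N v x) = create N (K v) (Γ.op x) := by
  have h1 : ∀ i, Γ.op ∘L create N (f i) = create N (K (f i)) ∘L Γ.op := by
    intro i
    refine HilbertBasis.clm_ext (fockBasis f) fun n => ?_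
    rw [ContinuousLinearMap.comp_apply, ContinuousLinearMap.comp_apply, h.apply_fockBasis, hK,
      fockBasis_apply, map_smul, map_smul, smul_apply, create_fockVec]
    split_ifs with hn
    · rw [map_smul, h.apply_fockVec, h.param.weight_add_single]
      simp only [smul_smul]
      congr 1
      push_cast
      ring
    · simp
  have h2 : Γ.op ∘L (create N).flip x = (create N).flip (Γ.op x) ∘L K := by
    refine HilbertBasis.clm_ext f fun i => ?_
    exact congrArg (fun T : Fock H →L[ℂ] Fock H => T x) (h1 i)
  exact congrArg (fun T : H →L[ℂ] Fock H => T v) h2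

/-- Induction through the intertwining relation. The g k may be any eigenvectors of K, so the result
covers a change of basis within degenerate eigenspaces. -/
theorem IsFreeWith.apply_symProd_map (h : IsFreeWith Γ f z) {K : H →L[ℂ] H}
    (hK : ∀ i, K (f i) = (z i : ℂ) • f i) {κ : Type*} {g : κ → H} {w : κ → ℝ}
    (hg : ∀ k, K (g k) = (w k : ℂ) • g k) (L : List κ) :
    Γ.op (symProd (L.map g)) =
      ((vacWeight z : ℂ) * ((L.map w).prod : ℝ)) • symProd (L.map g) := by
  induction L with
  | nil => simpa using h.apply_symProd_nil
  | cons k L ih =>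
    have h1 : symProd ((k :: L).map g) = create L.length (g k) (symProd (L.map g)) := by
      rw [create_symProd, if_pos (by simp), List.map_cons]
    rw [h1, h.apply_create hK, ih, hg, map_smul, map_smul, smul_apply, smul_smul,
      List.map_cons, List.prod_cons]
    congr 1
    push_cast
    ring

theorem posTrace_real_smul {E : Type u} [NormedAddCommGroup E] [InnerProductSpace ℂ E]
    [CompleteSpace E] {c : ℝ} (hc : 0 ≤ c) (A : E →L[ℂ] E) :
    posTrace ((c : ℂ) • A) = ENNReal.ofReal c * posTrace A := by
  unfold posTrace
  rw [← ENNReal.tsum_mul_left]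
  refine tsum_congr fun e => ?_
  rw [smul_apply, inner_smul_right, Complex.re_ofReal_mul, ENNReal.ofReal_mul hc]

variable [CompleteSpace H]

/-- Free states with compatible parameters are equal. -/
theorem IsFreeWith.unique (h : IsFreeWith Γ f z) {κ : Type u} {g : HilbertBasis κ ℂ H}
    {w : κ → ℝ} {Γ' : DensityOperator (Fock H)} (h' : IsFreeWith Γ' g w)
    (hc : ∀ i k, ⟪f i, g k⟫_ℂ ≠ 0 → z i = w k) : Γ = Γ' := by
  obtain ⟨K, -, hK⟩ := exists_diagonal f h.param.nonneg h.param.summable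
  -- In the expansion of g k in `f` only vectors with eigenvalue w k occur, by compatibility.
  have hKg : ∀ k, K (g k) = (w k : ℂ) • g k := by
    intro k
    refine (HilbertBasis.hasSum_diagonal f hK (g k)).unique ?_
    have h1 := (HilbertBasis.hasSum_inner_smul f (g k)).const_smul (w k : ℂ)
    convert! h1 using 1
    ext i
    rw [smul_smul]
    by_cases h0 : ⟪f i, g k⟫_ℂ = 0
    · simp [h0]
    · rw [hc i k h0]
  -- Both states have the same monomial factors on the Fock basis of g, so they are proportional;
  -- equal traces give c = 1 without comparing the infinite products.
  set c : ℝ := vacWeight z / vacWeight w with hcdef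
  have hcpos : 0 < c := div_pos h.param.vacWeight_pos h'.param.vacWeight_pos
  have hop : Γ.op = (c : ℂ) • Γ'.op := by
    refine HilbertBasis.clm_ext (fockBasis g) fun n => ?_
    rw [fockBasis_apply, fockVec_eq, map_smul, map_smul, smul_apply, occVec,
      h.apply_symProd_map hK hKg, h'.apply_symProd_map hKg hKg]
    rw [smul_smul (c : ℂ)]
    congr 2
    have : (vacWeight w : ℂ) ≠ 0 := by exact_mod_cast h'.param.vacWeight_pos.ne'
    rw [hcdef]
    push_cast
    field_simp
  have hc1 : c = 1 := by
    have := Γ.trace_eq_one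
    rw [hop, posTrace_real_smul hcpos.le, Γ'.trace_eq_one, mul_one] at this
    simpa using this
  rw [hc1, Complex.ofReal_one, one_smul] at hop
  cases Γ
  cases Γ'
  cases hop
  rfl

end Free

/-! ### The scalar inequality for one mode -/

noncomputable section ModeEntropy

/-- The entropy `(1 + x) log (1 + x) - x log x` of a mode with mean occupation number `x`. -/
def modeEntropy (x : ℝ) : ℝ := (1 + x) * Real.log (1 + x) - x * Real.log x

theorem modeEntropy_zero : modeEntropy 0 = 0 := by simp [modeEntropy]

/-- `-log (1 - z) - x log z`, with values in `[0, ∞]`. -/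
def modeCross (z x : ℝ) : ℝ≥0∞ :=
  ENNReal.ofReal (-Real.log (1 - z)) + negLog z * ENNReal.ofReal x

theorem modeEntropy_eq {x : ℝ} (hx : 0 < x) :
    modeEntropy x = -Real.log (1 - x / (1 + x)) + -Real.log (x / (1 + x)) * x := by
  have h1 : 0 < 1 + x := by linarith
  have h2 : 1 - x / (1 + x) = (1 + x)⁻¹ := by field_simp; ring
  rw [h2, Real.log_inv, Real.log_div hx.ne' h1.ne', modeEntropy]
  ring

theorem modeCross_of_pos {z x : ℝ} (hz : 0 < z) (hz1 : z < 1) (hx : 0 ≤ x) :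
    modeCross z x = ENNReal.ofReal (-Real.log (1 - z) + -Real.log z * x) := by
  have h1 : 0 ≤ -Real.log z := neg_nonneg.2 (Real.log_nonpos hz.le hz1.le)
  have h2 : 0 ≤ -Real.log (1 - z) := neg_nonneg.2 (Real.log_nonpos (by linarith) (by linarith))
  rw [modeCross, negLog, if_neg hz.not_ge, ← ENNReal.ofReal_mul h1,
    ← ENNReal.ofReal_add h2 (mul_nonneg h1 hx)]

theorem modeCross_self {x : ℝ} (hx : 0 ≤ x) :
    modeCross (x / (1 + x)) x = ENNReal.ofReal (modeEntropy x) := by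
  rcases hx.eq_or_lt with rfl | hx'
  · simp [modeCross, modeEntropy_zero]
  · have h1 : 0 < 1 + x := by linarith
    rw [modeCross_of_pos (div_pos hx' h1) ((div_lt_one h1).2 (by linarith)) hx, modeEntropy_eq hx']

/-- The gap is the relative entropy of two geometric distributions. With w = x/(1+x), applying log t
≤ t - 1 to (1-z)/(1-w) and to z/w, the latter weighted by x, bounds it below by 0; the second
inequality is strict as z ≠ w. The cases x = 0 and z = 0 are separate, the latter having infinite
cross term. -/
theorem modeEntropy_lt_modeCross {z x : ℝ} (hz : 0 ≤ z) (hz1 : z < 1) (hx : 0 ≤ x)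
    (hne : z ≠ x / (1 + x)) : ENNReal.ofReal (modeEntropy x) < modeCross z x := by
  have h1 : 0 < 1 + x := by linarith
  rcases hx.eq_or_lt with rfl | hx'
  · rw [modeEntropy_zero, modeCross]
    have hz' : 0 < z := hz.lt_of_ne (by simpa using hne.symm)
    have : 0 < -Real.log (1 - z) := neg_pos.2 (Real.log_neg (by linarith) (by linarith))
    simpa using this
  rcases hz.eq_or_lt with rfl | hz'
  · rw [modeCross, negLog, if_pos le_rfl, ENNReal.top_mul (by simpa using hx')]
    simp
  set w := x / (1 + x) with hw
  have hw0 : 0 < w := div_pos hx' h1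
  have hxw : x = w * (1 + x) := by rw [hw]; field_simp
  have h1w : 1 - w = (1 + x)⁻¹ := by rw [hw]; field_simp; ring
  have h1w0 : 0 < 1 - w := by rw [h1w]; positivity
  have hz1' : 0 < 1 - z := by linarith
  have e1 : Real.log ((1 - z) / (1 - w)) ≤ (1 - z) / (1 - w) - 1 :=
    Real.log_le_sub_one_of_pos (div_pos hz1' h1w0)
  have e2 : Real.log (z / w) < z / w - 1 := by
    refine Real.log_lt_sub_one_of_pos (div_pos hz' hw0) ?_
    rwa [Ne, div_eq_one_iff_eq hw0.ne']
  rw [Real.log_div hz1'.ne' h1w0.ne'] at e1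
  rw [Real.log_div hz'.ne' hw0.ne'] at e2
  have e3 : (1 - z) / (1 - w) = (1 - z) * (1 + x) := by rw [h1w, div_inv_eq_mul]
  have e4 : x * (z / w) = z * (1 + x) := by
    rw [hw]; field_simp
  have e5 := mul_lt_mul_of_pos_left e2 hx'
  rw [mul_sub, mul_sub, e4] at e5
  rw [e3] at e1
  have key : modeEntropy x < -Real.log (1 - z) + -Real.log z * x := by
    rw [modeEntropy_eq hx', ← hw]
    nlinarith
  rw [modeCross_of_pos hz' hz1 hx]
  refine (ENNReal.ofReal_lt_ofReal_iff_of_nonneg ?_).2 key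
  rw [modeEntropy_eq hx', ← hw]
  have a1 : Real.log (1 - w) ≤ 0 := Real.log_nonpos h1w0.le (by linarith)
  have a2 : Real.log w ≤ 0 := Real.log_nonpos hw0.le (by linarith)
  nlinarith

theorem modeEntropy_le_modeCross {z x : ℝ} (hz : 0 ≤ z) (hz1 : z < 1) (hx : 0 ≤ x) :
    ENNReal.ofReal (modeEntropy x) ≤ modeCross z x := by
  by_cases h : z = x / (1 + x)
  · rw [h, modeCross_self hx]
  · exact (modeEntropy_lt_modeCross hz hz1 hx h).le

theorem modeEntropy_nonneg {x : ℝ} (hx : 0 ≤ x) : 0 ≤ modeEntropy x := by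
  rcases hx.eq_or_lt with rfl | hx'
  · rw [modeEntropy_zero]
  have : Real.log x ≤ Real.log (1 + x) := Real.log_le_log hx' (by linarith)
  have h2 : 0 ≤ Real.log (1 + x) := Real.log_nonneg (by linarith)
  rw [modeEntropy]
  nlinarith

/-- Use log(1+x) ≤ x and bound the factor 1 + n i by 1 + ∑ n. -/
theorem summable_one_add_mul_log {ι : Type*} {n : ι → ℝ} (h0 : ∀ i, 0 ≤ n i) (hs : Summable n) :
    Summable fun i => (1 + n i) * Real.log (1 + n i) := by
  refine Summable.of_nonneg_of_le (fun i => ?_) (fun i => ?_) (hs.mul_left (1 + ∑' i, n i))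
  · have := h0 i
    exact mul_nonneg (by linarith) (Real.log_nonneg (by linarith))
  · have h1 := h0 i
    have h2 : n i ≤ ∑' i, n i := hs.le_tsum i fun j _ => h0 j
    have h3 : Real.log (1 + n i) ≤ n i := by
      have := Real.log_le_sub_one_of_pos (x := 1 + n i) (by linarith)
      linarith
    exact mul_le_mul (by linarith) h3 (Real.log_nonneg (by linarith)) (by linarith)

/-- The sum of the mode entropies, split into two sums. -/
theorem exists_hasSum_modeEntropy {ι : Type*} {n : ι → ℝ} (h0 : ∀ i, 0 ≤ n i) (hs : Summable n) :
    ∃ (A : ℝ) (B : EReal),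
      HasSum (fun i => (1 + n i) * Real.log (1 + n i)) A ∧
      HasSum (fun i => ((n i * Real.log (n i) : ℝ) : EReal)) B ∧
      ((∑' i, ENNReal.ofReal (modeEntropy (n i)) : ℝ≥0∞) : EReal) = (A : EReal) - B := by
  set S := ∑' i, ENNReal.ofReal (modeEntropy (n i)) with hS
  have hA := (summable_one_add_mul_log h0 hs).hasSum
  set A := ∑' i, (1 + n i) * Real.log (1 + n i) with hAdef
  -- S may be ∞, so the second sum is defined as A - S; its partial sums converge because addition
  -- on `EReal` is continuous where one argument is finite.
  refine ⟨A, (A : EReal) - S, hA, ?_, ?_⟩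
  · have h1 : Tendsto (fun s : Finset ι => ((∑ i ∈ s, (1 + n i) * Real.log (1 + n i) : ℝ) : EReal))
        atTop (𝓝 (A : EReal)) := (continuous_coe_real_ereal.tendsto A).comp hA
    have h2 : Tendsto (fun s : Finset ι =>
        -((∑ i ∈ s, ENNReal.ofReal (modeEntropy (n i)) : ℝ≥0∞) : EReal)) atTop (𝓝 (-(S : EReal))) :=
      (continuous_neg.tendsto _).comp ((continuous_coe_ennreal_ereal.tendsto S).comp
        (ENNReal.summable (f := fun i => ENNReal.ofReal (modeEntropy (n i)))).hasSum)
    have h3 := (EReal.continuousAt_add (p := ((A : EReal), -(S : EReal)))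
      (Or.inl (EReal.coe_ne_top A)) (Or.inl (EReal.coe_ne_bot A))).tendsto.comp
      (h1.prodMk_nhds h2)
    refine h3.congr fun s => ?_
    have h4 : ∑ i ∈ s, ENNReal.ofReal (modeEntropy (n i)) =
        ENNReal.ofReal (∑ i ∈ s, modeEntropy (n i)) :=
      (ENNReal.ofReal_sum_of_nonneg fun i _ => modeEntropy_nonneg (h0 i)).symm
    have h5 : ∀ t : Finset ι, ∑ i ∈ t, ((n i * Real.log (n i) : ℝ) : EReal) =
        ((∑ i ∈ t, n i * Real.log (n i) : ℝ) : EReal) := fun t =>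
      (map_sum (⟨⟨Real.toEReal, EReal.coe_zero⟩, EReal.coe_add⟩ : ℝ →+ EReal) _ t).symm
    simp only [Function.comp_apply]
    rw [h4, EReal.coe_ennreal_ofReal, max_eq_left
      (Finset.sum_nonneg fun i _ => modeEntropy_nonneg (h0 i)), ← EReal.coe_neg, ← EReal.coe_add,
      h5]
    congr 1
    rw [← sub_eq_add_neg, ← Finset.sum_sub_distrib]
    exact Finset.sum_congr rfl fun i _ => by rw [modeEntropy]; ring
  · rcases eq_or_ne S ⊤ with h | h
    · rw [h]
      simp
    · clear_value S
      lift S to NNReal using h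
      rw [EReal.coe_nnreal_eq_coe_real, ← EReal.coe_sub, ← EReal.coe_sub]
      congr 1
      ring

end ModeEntropy

/-! ### Comparison of free states in the eigenbasis of the `1`-matrix -/

noncomputable section Eigen

variable {H : Type u} [NormedAddCommGroup H] [InnerProductSpace ℂ H]

theorem eigenvalue_nonneg {E : Type u} [NormedAddCommGroup E] [InnerProductSpace ℂ E]
    {κ : Type*} {A : E →L[ℂ] E} (hA : A.IsPositive) {g : κ → E} (hg : Orthonormal ℂ g) {n : κ → ℝ}
    (h : ∀ k, A (g k) = (n k : ℂ) • g k) (k : κ) : 0 ≤ n k := by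
  have h1 := hA.re_inner_nonneg_right (g k)
  rw [h, inner_smul_right, inner_self_eq_norm_sq_to_K, hg.1] at h1
  simpa using h1

variable [CompleteSpace H] {γ : H →L[ℂ] H} {κ : Type u} {g : HilbertBasis κ ℂ H} {n : κ → ℝ}

theorem summable_eigenvalues (hγ : γ.IsPositive) (htr : posTrace γ ≠ ⊤)
    (hg : ∀ k, γ (g k) = (n k : ℂ) • g k) : Summable n := by
  rw [posTrace_diagonal g hγ hg] at htr
  have := ENNReal.summable_toReal htr
  simpa only [ENNReal.toReal_ofReal (eigenvalue_nonneg hγ g.orthonormal hg _)] using this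

theorem isParam_of_eigenvalues {κ : Type*} {n : κ → ℝ} (h0 : ∀ k, 0 ≤ n k) (hs : Summable n) :
    IsParam fun k => n k / (1 + n k) where
  nonneg k := div_nonneg (h0 k) (by have := h0 k; linarith)
  lt_one k := (div_lt_one (by have := h0 k; linarith)).2 (by linarith)
  summable := Summable.of_nonneg_of_le (fun k => div_nonneg (h0 k) (by have := h0 k; linarith))
    (fun k => div_le_self (h0 k) (by have := h0 k; linarith)) hs

theorem IsFreeWith.isOneMatrix {Γ : DensityOperator (Fock H)}
    (h : IsFreeWith Γ g fun k => n k / (1 + n k)) (hγ : γ.IsPositive)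
    (hg : ∀ k, γ (g k) = (n k : ℂ) • g k) : IsOneMatrix Γ γ := by
  have h0 := eigenvalue_nonneg hγ g.orthonormal hg
  refine isOneMatrix_of_quadForm Γ hγ fun u _ => ?_
  rw [h.quadForm_eq, ofReal_re_inner_diagonal g h0 hg]
  refine tsum_congr fun k => ?_
  congr 2
  have : 1 + n k ≠ 0 := by have := h0 k; linarith
  field_simp
  ring

/-- The `1`-matrix of Γ' is diagonal in its own basis f with eigenvalues z_i/(1-z_i), and it equals
γ. Eigenvectors of γ that overlap share their eigenvalue, which inverts to z_i = n_k/(1+n_k). -/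
theorem IsFreeWith.eq_of_isOneMatrix {Γ : DensityOperator (Fock H)}
    (h : IsFreeWith Γ g fun k => n k / (1 + n k)) (hγ : γ.IsPositive) (htr : posTrace γ ≠ ⊤)
    (hg : ∀ k, γ (g k) = (n k : ℂ) • g k) {Γ' : DensityOperator (Fock H)} (hfree : IsFree Γ')
    (hone : IsOneMatrix Γ' γ) : Γ' = Γ := by
  classical
  obtain ⟨ι, f, z, hz⟩ := isFree_iff.1 hfree
  have h0 := eigenvalue_nonneg hγ g.orthonormal hg
  have hν0 : ∀ i, 0 ≤ z i / (1 - z i) := fun i =>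
    div_nonneg (hz.param.nonneg i) (sub_pos.2 (hz.param.lt_one i)).le
  have hq : ∀ i, quadForm Γ'.op (f i) = ENNReal.ofReal (z i / (1 - z i)) := by
    intro i
    rw [hz.quadForm_eq, tsum_eq_single i]
    · simp [f.orthonormal.1]
    · intro j hj
      rw [HilbertBasis.inner_eq_ite, if_neg hj]
      simp
  have hsum : Summable fun i => z i / (1 - z i) := by
    have h1 : ∑' i, ENNReal.ofReal (z i / (1 - z i)) ≠ ⊤ := by
      rw [posTrace_eq hγ f] at htr
      simpa only [(hone.quadForm_basis f _).2, hq] using htr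
    have := ENNReal.summable_toReal h1
    simpa only [ENNReal.toReal_ofReal (hν0 _)] using this
  obtain ⟨γ', hγ', hf⟩ := exists_diagonal f hν0 hsum
  have hone' : IsOneMatrix Γ' γ' := isOneMatrix_of_quadForm Γ' hγ' fun u _ => by
    rw [ofReal_re_inner_diagonal f hν0 hf, hz.quadForm_eq]
  obtain rfl := hone.unique hone'
  refine hz.unique h fun i k hik => ?_
  have h1 : ⟪γ (f i), g k⟫_ℂ = ⟪f i, γ (g k)⟫_ℂ := hγ.inner_left_eq_inner_right _ _
  rw [hf, hg, inner_smul_left, inner_smul_right, Complex.conj_ofReal] at h1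
  have h2 : z i / (1 - z i) = n k := by exact_mod_cast mul_right_cancel₀ hik h1
  have h3 : 1 - z i ≠ 0 := (sub_pos.2 (hz.param.lt_one i)).ne'
  change z i = n k / (1 + n k)
  rw [← h2]
  field_simp
  ring

variable {Δ : DensityOperator (Fock H)}

theorem IsFreeWith.neg_traceLog_eigen {Γ : DensityOperator (Fock H)}
    (h : IsFreeWith Γ g fun k => n k / (1 + n k)) (hγ : γ.IsPositive)
    (hg : ∀ k, γ (g k) = (n k : ℂ) • g k) (hΔ : IsOneMatrix Δ γ) :
    -traceLog Δ Γ = ((∑' k, ENNReal.ofReal (modeEntropy (n k)) : ℝ≥0∞) : EReal) := by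
  rw [h.neg_traceLog]
  congr 1
  refine tsum_congr fun k => ?_
  rw [← modeCross_self (eigenvalue_nonneg hγ g.orthonormal hg k), modeCross,
    ← (hΔ.quadForm_basis g k).2, re_inner_diagonal_self g hg]

omit [CompleteSpace H] in
theorem tsum_enorm_inner_mul {ι : Type u} (f : HilbertBasis ι ℂ H) (a : κ → ℝ≥0∞) :
    ∑' p : ι × κ, ‖⟪g p.2, f p.1⟫_ℂ‖ₑ ^ 2 * a p.2 = ∑' k, a k := by
  rw [ENNReal.tsum_prod', ENNReal.tsum_comm]
  refine tsum_congr fun k => ?_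
  change ∑' i, ‖⟪g k, f i⟫_ℂ‖ₑ ^ 2 * a k = a k
  rw [ENNReal.tsum_mul_right]
  have h1 : ∀ i, ‖⟪g k, f i⟫_ℂ‖ₑ ^ 2 = ‖⟪f i, g k⟫_ℂ‖ₑ ^ 2 := fun i => by
    rw [← inner_conj_symm, RCLike.enorm_conj]
  simp_rw [h1, HilbertBasis.tsum_enorm_inner_sq]
  rw [← ofReal_norm, g.orthonormal.1]
  simp

/-- The weights |⟨g_k,f_i⟩|² sum to 1 over k, which spreads the constant term, and average the n_k
to ⟨f_i|γ|f_i⟩, which spreads the linear one. -/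
theorem IsFreeWith.neg_traceLog_cross {Γ : DensityOperator (Fock H)} {ι : Type u}
    {f : HilbertBasis ι ℂ H} {z : ι → ℝ} (h : IsFreeWith Γ f z) (hγ : γ.IsPositive)
    (hg : ∀ k, γ (g k) = (n k : ℂ) • g k) (hΔ : IsOneMatrix Δ γ) :
    -traceLog Δ Γ = ((∑' p : ι × κ, ‖⟪g p.2, f p.1⟫_ℂ‖ₑ ^ 2 * modeCross (z p.1) (n p.2) : ℝ≥0∞) :
      EReal) := by
  rw [h.neg_traceLog]
  congr 1
  rw [ENNReal.tsum_prod']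
  refine tsum_congr fun i => ?_
  simp_rw [modeCross, mul_add]
  rw [ENNReal.tsum_add, ENNReal.tsum_mul_right, HilbertBasis.tsum_enorm_inner_sq,
    ← (hΔ.quadForm_basis f i).2, ofReal_re_inner_diagonal g
      (eigenvalue_nonneg hγ g.orthonormal hg) hg, ← ENNReal.tsum_mul_left, ← ofReal_norm,
    f.orthonormal.1]
  congr 1
  · simp
  · exact tsum_congr fun k => by ring

theorem IsFreeWith.modeEntropy_le {Γ : DensityOperator (Fock H)} {ι : Type u}
    {f : HilbertBasis ι ℂ H} {z : ι → ℝ} (h : IsFreeWith Γ f z) (hγ : γ.IsPositive)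
    (hg : ∀ k, γ (g k) = (n k : ℂ) • g k) (hΔ : IsOneMatrix Δ γ) :
    ((∑' k, ENNReal.ofReal (modeEntropy (n k)) : ℝ≥0∞) : EReal) ≤ -traceLog Δ Γ := by
  rw [h.neg_traceLog_cross hγ hg hΔ, EReal.coe_ennreal_le_coe_ennreal_iff,
    ← tsum_enorm_inner_mul f (g := g)]
  refine ENNReal.tsum_le_tsum fun p => ?_
  gcongr
  exact modeEntropy_le_modeCross (h.param.nonneg _) (h.param.lt_one _)
    (eigenvalue_nonneg hγ g.orthonormal hg _)

/-- A strict inequality at one pair (i, k) of positive weight would make the double sum strictly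
larger; finiteness of the smaller sum is essential here. -/
theorem IsFreeWith.eq_of_traceLog_eq {Γ Γ' : DensityOperator (Fock H)} {ι : Type u}
    {f : HilbertBasis ι ℂ H} {z : ι → ℝ} (h : IsFreeWith Γ f z)
    (h' : IsFreeWith Γ' g fun k => n k / (1 + n k)) (hγ : γ.IsPositive)
    (hg : ∀ k, γ (g k) = (n k : ℂ) • g k) (hΔ : IsOneMatrix Δ γ)
    (hfin : ∑' k, ENNReal.ofReal (modeEntropy (n k)) ≠ ⊤)
    (heq : -traceLog Δ Γ = ((∑' k, ENNReal.ofReal (modeEntropy (n k)) : ℝ≥0∞) : EReal)) :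
    Γ = Γ' := by
  refine h.unique h' fun i k hik => ?_
  by_contra hne
  rw [h.neg_traceLog_cross hγ hg hΔ, EReal.coe_ennreal_eq_coe_ennreal_iff,
    ← tsum_enorm_inner_mul f (g := g)] at heq
  rw [← tsum_enorm_inner_mul f (g := g)] at hfin
  have h0 := eigenvalue_nonneg hγ g.orthonormal hg
  refine (ENNReal.tsum_lt_tsum (i := (i, k)) hfin (fun p => ?_) ?_).ne' heq
  · gcongr
    exact modeEntropy_le_modeCross (h.param.nonneg _) (h.param.lt_one _) (h0 _)
  · have h1 : ‖⟪g k, f i⟫_ℂ‖ₑ ^ 2 ≠ 0 := by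
      rw [← inner_conj_symm, RCLike.enorm_conj]
      exact pow_ne_zero _ (by simpa using hik)
    have h2 : ‖⟪g k, f i⟫_ℂ‖ₑ ^ 2 ≠ ⊤ := by finiteness
    exact ENNReal.mul_lt_mul_right h1 h2
      (modeEntropy_lt_modeCross (h.param.nonneg _) (h.param.lt_one _) (h0 _) hne)

omit [CompleteSpace H] in
theorem isNaturalDecomposition_of_hilbertBasis (hg : ∀ k, γ (g k) = (n k : ℂ) • g k) :
    IsNaturalDecomposition γ g n :=
  ⟨g.orthonormal, HilbertBasis.hasSum_diagonal g hg⟩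

/-- A decomposition along an orthonormal system extends to an orthonormal basis of eigenvectors. -/
theorem IsNaturalDecomposition.exists_extension {ι : Type u} {g₀ : ι → H} {n₀ : ι → ℝ}
    (h : IsNaturalDecomposition γ g₀ n₀) :
    ∃ (κ : Type u) (g : HilbertBasis κ ℂ H) (n : κ → ℝ) (e : ι → κ), Function.Injective e ∧
      (∀ k, γ (g k) = (n k : ℂ) • g k) ∧ (∀ i, n (e i) = n₀ i) ∧ (∀ i, g (e i) = g₀ i) ∧
      ∀ k, k ∉ Set.range e → n k = 0 := by
  classical
  obtain ⟨w, b, hw, hb⟩ := h.1.toSubtypeRange.exists_hilbertBasis_extension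
  let e : ι → w := fun i => ⟨g₀ i, hw ⟨i, rfl⟩⟩
  have hbe : ∀ i, b (e i) = g₀ i := fun i => by rw [hb]
  have heinj : Function.Injective e := fun i j hij =>
    h.1.linearIndependent.injective (congrArg Subtype.val hij)
  have happ := Orthonormal.apply_of_hasSum h.1 h.2
  refine ⟨w, b, Function.extend e n₀ 0, e, heinj, fun k => ?_, heinj.extend_apply _ _, hbe,
    fun k hk => ?_⟩
  · by_cases hk : ∃ i, e i = k
    · obtain ⟨i, rfl⟩ := hk
      rw [heinj.extend_apply, hbe, happ]
    · rw [Function.extend_apply' _ _ _ hk]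
      refine (h.2 (b k)).unique ?_
      convert! hasSum_zero using 1
      · ext i
        rw [← hbe, HilbertBasis.inner_eq_ite, if_neg fun hi => hk ⟨i, hi⟩]
        simp
      · simp
  · rw [Function.extend_apply' _ _ _ hk]
    rfl

end Eigen

end BosonFock

/-! ### Assembly of the theorem -/

open BosonFock
theorem proposition2 {H : Type u} [NormedAddCommGroup H] [InnerProductSpace ℂ H]
    [CompleteSpace H]
    (Δ : DensityOperator (Fock H))
    (hcomm : CommutesWithNumber Δ.op)
    (hmean : meanNumber Δ < ⊤)
    (hent : ⊥ < traceLog Δ Δ) :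
    -- the `1`-matrix `γ` of `Δ`, and the unique free state `ΓΔ` with the same `1`-matrix
    ∃ (γ : H →L[ℂ] H) (ΓΔ : DensityOperator (Fock H)),
      (IsOneMatrix Δ γ ∧ ∀ γ', IsOneMatrix Δ γ' → γ' = γ) ∧
      (IsFree ΓΔ ∧ IsOneMatrix ΓΔ γ ∧ ∀ Γ, IsFree Γ → IsOneMatrix Γ γ → Γ = ΓΔ) ∧
      -- natural occupation numbers `n i` exist, and the formula for the nonfreeness holds for them
      (∃ (ι : Type u) (g : ι → H) (n : ι → ℝ), IsNaturalDecomposition γ g n) ∧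
      (∀ (ι : Type u) (g : ι → H) (n : ι → ℝ), IsNaturalDecomposition γ g n →
        (∀ i, 0 ≤ n i) ∧
        ∃ (A : ℝ) (B : EReal),
          HasSum (fun i => (1 + n i) * Real.log (1 + n i)) A ∧
          HasSum (fun i => ((n i * Real.log (n i) : ℝ) : EReal)) B ∧
          relEntropy Δ ΓΔ = (A : EReal) - B + traceLog Δ Δ) ∧
      -- the nonfreeness is the minimum of the entropies relative to free states
      IsLeast {s : EReal | ∃ Γ, IsFree Γ ∧ s = relEntropy Δ Γ} (relEntropy Δ ΓΔ) ∧
      -- uniqueness of the minimizer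
      (⊥ < traceLog Δ ΓΔ → ∀ Γ, IsFree Γ → relEntropy Δ Γ = relEntropy Δ ΓΔ → Γ = ΓΔ) := by
  obtain ⟨w, b, -⟩ := exists_hilbertBasis ℂ H
  rw [meanNumber_eq b] at hmean
  obtain ⟨γ, hγ, hq⟩ := exists_oneMatrix b Δ.isPositive hmean.ne
  have hone : IsOneMatrix Δ γ := isOneMatrix_of_quadForm Δ hγ fun u _ => hq u
  have htr : posTrace γ ≠ ⊤ := by
    rw [posTrace_eq hγ b]
    simpa only [hq] using hmean.ne
  obtain ⟨κ, g, n, hg⟩ := exists_hilbertBasis_eigenvectors hγ htr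
  obtain ⟨ΓΔ, hΓ⟩ := exists_isFreeWith g (isParam_of_eigenvalues
    (eigenvalue_nonneg hγ g.orthonormal hg) (summable_eigenvalues hγ htr hg))
  have huniq : ∀ Γ, IsFree Γ → IsOneMatrix Γ γ → Γ = ΓΔ := fun Γ h1 h2 =>
    hΓ.eq_of_isOneMatrix hγ htr hg h1 h2
  have hfree : IsFree ΓΔ := isFree_iff.2 ⟨κ, g, _, hΓ⟩
  have hS := hΓ.neg_traceLog_eigen hγ hg hone
  refine ⟨γ, ΓΔ, ⟨hone, fun γ' h => h.unique hone⟩, ⟨hfree, hΓ.isOneMatrix hγ hg, huniq⟩,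
    ⟨κ, g, n, isNaturalDecomposition_of_hilbertBasis hg⟩, fun ι g₀ n₀ hnat => ?_, ⟨⟨ΓΔ, hfree, rfl⟩, ?_⟩,
    fun hbot Γ hΓfree heq => ?_⟩
  -- An arbitrary decomposition is completed to an eigenbasis by eigenvalues 0. The free state built
  -- on it is again Γ_Δ by uniqueness, and the added modes have zero entropy.
  · obtain ⟨κ', g', n', e, he, hg', hn', -, hout⟩ := hnat.exists_extension
    have h0' := eigenvalue_nonneg hγ g'.orthonormal hg'
    have hs' := summable_eigenvalues hγ htr hg'
    have h0 : ∀ i, 0 ≤ n₀ i := fun i => hn' i ▸ h0' (e i)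
    have hs : Summable n₀ := by
      simpa only [Function.comp_def, hn'] using hs'.comp_injective he
    obtain ⟨Γ', hΓ'⟩ := exists_isFreeWith g' (isParam_of_eigenvalues h0' hs')
    obtain rfl : Γ' = ΓΔ := huniq Γ' (isFree_iff.2 ⟨κ', g', _, hΓ'⟩) (hΓ'.isOneMatrix hγ hg')
    refine ⟨h0, ?_⟩
    obtain ⟨A, B, hA, hB, hAB⟩ := exists_hasSum_modeEntropy h0 hs
    refine ⟨A, B, hA, hB, ?_⟩
    rw [relEntropy, hΓ'.neg_traceLog_eigen hγ hg' hone, ← hAB, ← he.tsum_eq]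
    · simp only [hn']
    · intro k hk
      by_contra hk'
      exact hk (by simp [hout k hk', modeEntropy_zero])
  · rintro _ ⟨Γ, hΓfree, rfl⟩
    obtain ⟨ι, f, z, hz⟩ := isFree_iff.1 hΓfree
    rw [relEntropy, relEntropy, hS]
    exact add_le_add_left (hz.modeEntropy_le hγ hg hone) _
  · obtain ⟨ι, f, z, hz⟩ := isFree_iff.1 hΓfree
    refine hz.eq_of_traceLog_eq hΓ hγ hg hone ?_ ?_
    · intro htop
      rw [htop] at hS
      have : traceLog Δ ΓΔ = ⊥ := by
        rw [← neg_neg (traceLog Δ ΓΔ), hS]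
        rfl
      exact hbot.ne' this
    -- Tr(Δ log Δ) is a real number, so it can be cancelled from the equality of relative entropies.
    · have htop : traceLog Δ Δ ≠ ⊤ := by
        rw [traceLog]
        intro h
        rw [EReal.neg_eq_top_iff] at h
        exact EReal.coe_ennreal_ne_bot _ h
      rw [relEntropy, relEntropy, hS] at heq
      generalize traceLog Δ Δ = t at *
      lift t to ℝ using ⟨htop, hent.ne'⟩
      have := congrArg (fun x : EReal => x - t) heq
      simpa only [EReal.add_sub_cancel_right] using this
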